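/- Conventions. Let $T_k\in[0,\infty]$, $1\le k<\infty$, with $T_k\to\infty$ (the choice $T_k\equiv\infty$ being allowed, and being the basic case), and put $T_\infty=\infty$. For $1\le k\le\infty$ let $Z^{(k)}=\{Z^{(k)}_t: t\in[0,\infty),\ t\le T_k\}$ be a separable centered Gaussian process with $\mathbb E[(Z^{(k)}_t)^2]=1$ and auto-correlation $A_k(s,t)=\mathbb E[Z^{(k)}_sZ^{(k)}_t]$. Let $\mathcal S$ be the class of stationary auto-correlation functions on $[0,\infty)$, that is, positive semidefinite kernels $A$ with $A(t,t)=1$ and $A(s,s+\tau)=A(0,\tau)$ for all $s,t,\tau\ge0$, and assume $A_\infty\in\mathcal S$. For $z\in\mathbb R$ and $M\in[0,\infty)$ let $(\mathrm{C}_{z,M})$ denote the inequalities $$\mathbb P\Big(\sup_{t\in[0,M]}Z^{(\infty)}_t<z\Big)\le\liminf_{k\to\infty}\inf_{s}\mathbb P\Big(\sup_{t\in[0,M]}Z^{(k)}_{s+t}<z\Big)\le\limsup_{k\to\infty}\sup_{s}\mathbb P\Big(\sup_{t\in[0,M]}Z^{(k)}_{s+t}<z\Big)\le\mathbb P\Big(\sup_{t\in[0,M]}Z^{(\infty)}_t\le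 z\Big),$$ where $s$ ranges over $s\ge0$ with $s+M\le T_k$ (over all $s\ge 0$ if $T_k=\infty$). (i) Suppose that $D\in\mathcal S$ is the auto-correlation of a centered Gaussian process on $[0,\infty)$ with continuous sample paths, and that for every finite $M$ there are $\epsilon_k>0$ with $\epsilon_k\to0$ such that for all $k<\infty$, $\tau\in[0,M]$ and $s\ge0$ with $s+\tau\le T_k$, $$(1-\epsilon_k)A_\infty(0,\tau)+\epsilon_kD(0,\tau)\le A_k(s,s+\tau)\le(1-\epsilon_k)A_\infty(0,\tau)+\epsilon_k.$$ Then there exist $\zeta>0$ and $M_1<\infty$ such that $(\mathrm{C}_{z,M})$ holds for all $z\in[0,\zeta]$ and all $M\ge M_1$. (ii) Put $p_k(u):=\big(2-2\inf\{A_k(s,s+\tau): s\ge0,\ \tau\in[0,u],\ s+\tau\le T_k\}\big)^{1/2}$ for $1\le k\le\infty$, and suppose that $A_k(s,s+\tau)\to A_\infty(0,\tau)$ as $k\to\infty$ for all $s,\tau\ge0$, and $$\lim_{\delta\downarrow0}\ \sup_{1\le k\le\infty}\int_0^\infty\big[p_k(e^{-v^2})\wedge\delta\big]\,dv=0.$$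 Then for every $M\in[0,\infty)$ the processes $\{Z^{(k)}_{s+t}\}_{t\in[0,M]}$, $1\le k\le\infty$, $s\ge0$, $s+M\le T_k$, have almost surely continuous paths, and their laws are uniformly tight on $C[0,M]$ with the supremum norm. If moreover every $A_k$, $k<\infty$, is stationary on its time set (that is, $A_k(s,s+\tau)=A_k(0,\tau)$ whenever $s+\tau\le T_k$), then $(\mathrm{C}_{z,M})$ holds for all $z\in\mathbb R$ and all $M\in[0,\infty)$. -/

import Mathlib

open MeasureTheory ProbabilityTheory Filter Topology
open scoped NNReal ENNReal

/-- The time set `[0, T]`, which is `[0, ∞)` when `T = ∞`. -/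
def timeDomain (T : ℝ≥0∞) : Set ℝ≥0 := {t | (t : ℝ≥0∞) ≤ T}

/-- `A` is a stationary auto-correlation function on the time set `J`: a positive semidefinite
(in particular symmetric) kernel, equal to one on the diagonal, which depends on the time lag
only. For `J = [0, ∞)` this is the class of all stationary auto-correlation functions. -/
structure IsStationaryCorrelationOn (J : Set ℝ≥0) (A : ℝ≥0 → ℝ≥0 → ℝ) : Prop where
  posSemidef : Matrix.PosSemidef (Matrix.of fun s t : J => A s t)
  diag : ∀ t ∈ J, A t t = 1
  stationary : ∀ s τ : ℝ≥0, s + τ ∈ J → A s (s + τ) = A 0 τ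

/-- `(X_t)_{t ∈ J}` is a centered Gaussian process on `J`, normalized to unit variance, with
auto-correlation function `A`. -/
structure IsGaussianWithCorrelationOn {Ω : Type*} [MeasurableSpace Ω] (P : Measure Ω)
    (J : Set ℝ≥0) (X : ℝ≥0 → Ω → ℝ) (A : ℝ≥0 → ℝ≥0 → ℝ) : Prop where
  gaussian : IsGaussianProcess (fun t : J => X t) P
  centered : ∀ t ∈ J, ∫ ω, X t ω ∂P = 0
  normalized : ∀ t ∈ J, ∫ ω, X t ω ^ 2 ∂P = 1
  correlation : ∀ s ∈ J, ∀ t ∈ J, cov[X s, X t; P] = A s t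

/-- Separability in the sense of Doob: there is a countable set `S ⊆ J` such that almost surely,
for every `t ∈ J`, the point `(t, X_t)` is a limit of points `(s, X_s)` with `s ∈ S`. -/
def IsSeparableOn {Ω : Type*} [MeasurableSpace Ω] (P : Measure Ω)
    (J : Set ℝ≥0) (X : ℝ≥0 → Ω → ℝ) : Prop :=
  ∃ S : Set ℝ≥0, S ⊆ J ∧ S.Countable ∧
    ∀ᵐ ω ∂P, ∀ t ∈ J, (t, X t ω) ∈ closure ((fun s : ℝ≥0 => (s, X s ω)) '' S)

/-- `sup_{t ∈ [0, M]} X_{s + t}`, as an extended real number. -/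
noncomputable def pathSup {Ω : Type*} (X : ℝ≥0 → Ω → ℝ) (s M : ℝ≥0) (ω : Ω) : EReal :=
  ⨆ (t : ℝ≥0) (_ : t ≤ M), (X (s + t) ω : EReal)

section Family

variable {Ω : ℕ∞ → Type*} [∀ k, MeasurableSpace (Ω k)]

/-- The chain of inequalities
`P(sup_{[0,M]} Z^∞ < z) ≤ liminf_k inf_s P(sup_{[0,M]} Z^k_{s+·} < z)`
`≤ limsup_k sup_s P(sup_{[0,M]} Z^k_{s+·} < z) ≤ P(sup_{[0,M]} Z^∞ ≤ z)`,
where `s` ranges over all `s ≥ 0` with `[s, s + M]` inside the time set of `Z^k`. -/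
def SupProbConvergesAt (P : ∀ k, Measure (Ω k)) (T : ℕ∞ → ℝ≥0∞)
    (Z : ∀ k, ℝ≥0 → Ω k → ℝ) (z : ℝ) (M : ℝ≥0) : Prop :=
  P ⊤ {ω | pathSup (Z ⊤) 0 M ω < z}
      ≤ liminf (fun k : ℕ => ⨅ (s : ℝ≥0) (_ : s + M ∈ timeDomain (T k)),
          P k {ω | pathSup (Z k) s M ω < z}) atTop ∧
  liminf (fun k : ℕ => ⨅ (s : ℝ≥0) (_ : s + M ∈ timeDomain (T k)),
          P k {ω | pathSup (Z k) s M ω < z}) atTop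
      ≤ limsup (fun k : ℕ => ⨆ (s : ℝ≥0) (_ : s + M ∈ timeDomain (T k)),
          P k {ω | pathSup (Z k) s M ω < z}) atTop ∧
  limsup (fun k : ℕ => ⨆ (s : ℝ≥0) (_ : s + M ∈ timeDomain (T k)),
          P k {ω | pathSup (Z k) s M ω < z}) atTop
      ≤ P ⊤ {ω | pathSup (Z ⊤) 0 M ω ≤ z}

/-- The inequalities hold for all `z ∈ [0, ζ]` and all `M ≥ M₁`, for some `ζ > 0`, `M₁ < ∞`. -/
def SupProbConverges (P : ∀ k, Measure (Ω k)) (T : ℕ∞ → ℝ≥0∞)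
    (Z : ∀ k, ℝ≥0 → Ω k → ℝ) : Prop :=
  ∃ ζ : ℝ, 0 < ζ ∧ ∃ M₁ : ℝ≥0, ∀ z ∈ Set.Icc 0 ζ, ∀ M : ℝ≥0, M₁ ≤ M →
    SupProbConvergesAt P T Z z M

end Family

/-- The modulus `p(u)`, where `p(u)² = 2 - 2 inf {A(s, s + τ) : s ≥ 0, τ ∈ [0, u]}`, the infimum
being over those `s, τ` for which `s + τ` is in the time set `J`. -/
noncomputable def corrModulus (J : Set ℝ≥0) (A : ℝ≥0 → ℝ≥0 → ℝ) (u : ℝ) : ℝ :=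
  Real.sqrt (2 - 2 * sInf {a : ℝ | ∃ s τ : ℝ≥0, (τ : ℝ) ≤ u ∧ s + τ ∈ J ∧ a = A s (s + τ)})

/-- The uniform Dudley-type condition
`lim_{δ ↓ 0} sup_{1 ≤ k ≤ ∞} ∫_0^∞ min (p_k(exp(-v²))) δ dv = 0`. -/
def UniformDudley (T : ℕ∞ → ℝ≥0∞) (A : ℕ∞ → ℝ≥0 → ℝ≥0 → ℝ) : Prop :=
  Tendsto (fun δ : ℝ => ⨆ k : ℕ∞, ∫⁻ v in Set.Ioi (0 : ℝ),
      ENNReal.ofReal (min (corrModulus (timeDomain (T k)) (A k) (Real.exp (-v ^ 2))) δ))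
    (𝓝[>] 0) (𝓝 0)

/-- The Borel σ-algebra of the supremum norm on `C[0, M]`. -/
instance instMeasurableSpaceCIcc (M : ℝ≥0) : MeasurableSpace C(Set.Icc (0 : ℝ≥0) M, ℝ) :=
  borel _

instance instBorelSpaceCIcc (M : ℝ≥0) : BorelSpace C(Set.Icc (0 : ℝ≥0) M, ℝ) := ⟨rfl⟩

/-- The laws on `C[0, M]` of the processes `(Z^k_{s+t})_{t ∈ [0, M]}`, over all `1 ≤ k ≤ ∞` and
all `s ≥ 0` with `[s, s + M]` inside the time set of `Z^k`, are well defined and uniformly tight: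
each such process coincides almost surely, at all times `t ∈ [0, M]` simultaneously, with a random
element `Y k s` of `C[0, M]`, and the collection of the laws of the `Y k s` is tight. -/
def UniformlyTightOn {Ω : ℕ∞ → Type*} [∀ k, MeasurableSpace (Ω k)] (P : ∀ k, Measure (Ω k))
    (T : ℕ∞ → ℝ≥0∞) (Z : ∀ k, ℝ≥0 → Ω k → ℝ) (M : ℝ≥0) : Prop :=
  ∃ Y : ∀ k, ℝ≥0 → Ω k → C(Set.Icc (0 : ℝ≥0) M, ℝ),
    (∀ k s, s + M ∈ timeDomain (T k) →
      Measurable (Y k s) ∧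
      ∀ᵐ ω ∂(P k), ∀ t : Set.Icc (0 : ℝ≥0) M, Y k s ω t = Z k (s + t) ω) ∧
    IsTightMeasureSet {μ | ∃ k s, s + M ∈ timeDomain (T k) ∧ μ = (P k).map (Y k s)}

/-! Everything rests on a quantitative Slepian inequality. For centered Gaussian vectors `X`, `Y`
with equal variances and levels `a < b`, `P(Y ≤ a) ≤ P(X < b) + C Σ (cov Y - cov X)⁺`, where `C`
depends only on the index set, `a` and `b`. The proof is Lindeberg's: the orthant indicator is
replaced by a product of smooth nonincreasing steps, both vectors are cut into `n` independent
pieces, and the pieces are exchanged one at a time. The diagonal second-order terms cancel, the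
mixed coefficients of the product are nonnegative, and the third-order errors add up to
`O(n^(-1/2))`. See `exists_prod_expansion` and `integral_le_add_covExcess_of_expansion`.

In part (i) the sandwich places the correlation of each window of `Z^k` between those of `√(1-ε) Z^∞
+ √ε V` and `√(1-ε) Z^∞ + √ε N`, with `V` independent of correlation `D` and `N` a single
independent standard normal. Slepian's inequality then has no error term. As `ε → 0` the
perturbations disappear, because `V` is almost surely bounded on `[0, M]` and `N` is finite.

In part (ii) chaining runs over grids of mesh `2^(-4^n)`. Their log-cardinality is of order `4^n`,
so increments of level `n` exceeding `5 · 2^n p(mesh)` have summable probability, and the sum of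
these thresholds is dominated by the entropy integral. The uniform Dudley condition thus yields one
modulus of continuity for all `k` and `s`, and Arzelà-Ascoli gives tightness. For the probabilities,
stationarity makes the convergence of correlations on a finite set of times uniform in the shift.
Upper bounds then follow from finite sets and separability, lower bounds from a fine grid together
with the common modulus. -/

/-! ### Smooth steps and the expansion of their products. -/

/-- If a function vanishes at `0` and its derivative is `O(|t|ⁿ)` with constant `K`, then the
function is `O(|t|ⁿ⁺¹)` with the same constant. -/
theorem abs_le_mul_abs_pow_succ_of_deriv {g g' : ℝ → ℝ} {K : ℝ} (hK : 0 ≤ K) {n : ℕ}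
    (hg : ∀ t, HasDerivAt g (g' t) t) (h0 : g 0 = 0) (hb : ∀ t, |g' t| ≤ K * |t| ^ n) (x : ℝ) :
    |g x| ≤ K * |x| ^ (n + 1) := by
  have key := (convex_uIcc (0 : ℝ) x).norm_image_sub_le_of_norm_hasDerivWithin_le (f := g)
    (f' := g') (C := K * |x| ^ n) (fun t _ => (hg t).hasDerivWithinAt)
    (fun t ht => by
      have : |t| ≤ |x| := by simpa using Set.abs_sub_left_of_mem_uIcc ht
      rw [Real.norm_eq_abs]
      refine (hb t).trans ?_
      gcongr) Set.left_mem_uIcc Set.right_mem_uIcc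
  simp only [h0, sub_zero, Real.norm_eq_abs] at key
  calc |g x| ≤ K * |x| ^ n * |x| := key
    _ = _ := by ring

/-- `φ` takes values in `[0, 1]`, is nonincreasing, and has Taylor expansions of orders zero, one
and two with uniform constant `K`; here `φ₁` and `φ₂` are its first two derivatives. -/
structure IsSmoothStep (φ φ₁ φ₂ : ℝ → ℝ) (K : ℝ) : Prop where
  nonneg : ∀ x, 0 ≤ φ x
  le_one : ∀ x, φ x ≤ 1
  deriv_nonpos : ∀ x, φ₁ x ≤ 0
  abs_deriv_le : ∀ x, |φ₁ x| ≤ K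
  abs_deriv2_le : ∀ x, |φ₂ x| ≤ K
  taylor0 : ∀ w x, |φ (w + x) - φ w| ≤ K * |x|
  taylor1 : ∀ w x, |φ (w + x) - φ w - φ₁ w * x| ≤ K * |x| ^ 2
  taylor2 : ∀ w x, |φ (w + x) - φ w - φ₁ w * x - φ₂ w / 2 * x ^ 2| ≤ K * |x| ^ 3

/-- A smooth nonincreasing function equal to `1` on `(-∞, a]` and to `0` on `[b, ∞)`. -/
theorem exists_isSmoothStep {a b : ℝ} (hab : a < b) : ∃ (φ φ₁ φ₂ : ℝ → ℝ) (K : ℝ),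
    IsSmoothStep φ φ₁ φ₂ K ∧ Continuous φ ∧ (∀ x ≤ a, φ x = 1) ∧ ∀ x, b ≤ x → φ x = 0 := by
  have hba : 0 < b - a := sub_pos.2 hab
  set φ : ℝ → ℝ := fun x => Real.smoothTransition ((b - x) / (b - a)) with hφ
  have hsm : ContDiff ℝ 3 φ := by
    apply (Real.smoothTransition.contDiff (n := 3)).comp
    fun_prop
  have hanti : Antitone φ := fun x y hxy => by
    apply Real.smoothTransition.monotone
    gcongr
  have h1 : ∀ x ≤ a, φ x = 1 := fun x hx => by
    apply Real.smoothTransition.one_of_one_le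
    rw [le_div_iff₀ hba]; linarith
  have h0 : ∀ x, b ≤ x → φ x = 0 := fun x hx => by
    apply Real.smoothTransition.zero_of_nonpos
    exact div_nonpos_of_nonpos_of_nonneg (by linarith) hba.le
  have hd1 : ContDiff ℝ 2 (deriv φ) := hsm.deriv' (n := 2)
  have hd2 : ContDiff ℝ 1 (deriv (deriv φ)) := hd1.deriv' (n := 1)
  have hd3 : ContDiff ℝ 0 (deriv (deriv (deriv φ))) := hd2.deriv' (n := 0)
  have hsupp : HasCompactSupport (deriv φ) := by
    refine HasCompactSupport.intro (isCompact_Icc (a := a) (b := b)) fun x hx => ?_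
    rw [Set.mem_Icc, not_and_or, not_le, not_le] at hx
    rcases hx with hx | hx
    · have : φ =ᶠ[𝓝 x] fun _ => 1 := by
        filter_upwards [Iio_mem_nhds hx] with y hy using h1 y hy.le
      rw [this.deriv_eq]; simp
    · have : φ =ᶠ[𝓝 x] fun _ => 0 := by
        filter_upwards [Ioi_mem_nhds hx] with y hy using h0 y hy.le
      rw [this.deriv_eq]; simp
  obtain ⟨K1, hK1⟩ := hsupp.exists_bound_of_continuous hd1.continuous
  obtain ⟨K2, hK2⟩ := hsupp.deriv.exists_bound_of_continuous hd2.continuous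
  obtain ⟨K3, hK3⟩ := hsupp.deriv.deriv.exists_bound_of_continuous hd3.continuous
  simp only [Real.norm_eq_abs] at hK1 hK2 hK3
  set K := max K1 (max K2 K3)
  have k1 : ∀ x, |deriv φ x| ≤ K := fun x => (hK1 x).trans (le_max_left _ _)
  have k2 : ∀ x, |deriv (deriv φ) x| ≤ K := fun x =>
    (hK2 x).trans ((le_max_left _ _).trans (le_max_right _ _))
  have k3 : ∀ x, |deriv (deriv (deriv φ)) x| ≤ K := fun x =>
    (hK3 x).trans ((le_max_right _ _).trans (le_max_right _ _))
  have hK : 0 ≤ K := (abs_nonneg _).trans (k1 0)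
  have D : ∀ (f : ℝ → ℝ), Differentiable ℝ f → ∀ w t, HasDerivAt (fun t => f (w + t))
      (deriv f (w + t)) t := fun f hf w t => by
    exact (hf (w + t)).hasDerivAt.comp_const_add w t
  have T0 : ∀ f : ℝ → ℝ, Differentiable ℝ f → (∀ x, |deriv f x| ≤ K) → ∀ w x,
      |f (w + x) - f w| ≤ K * |x| := fun f hf hb w x => by
    simpa using abs_le_mul_abs_pow_succ_of_deriv hK (n := 0)
      (fun t => (D f hf w t).sub_const (f w)) (by simp) (fun t => by simpa using hb (w + t)) x
  have T1 : ∀ f : ℝ → ℝ, Differentiable ℝ f → Differentiable ℝ (deriv f) →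
      (∀ x, |deriv (deriv f) x| ≤ K) → ∀ w x,
      |f (w + x) - f w - deriv f w * x| ≤ K * |x| ^ 2 := fun f hf hf' hb w x => by
    refine abs_le_mul_abs_pow_succ_of_deriv hK (n := 1)
      (g := fun x => f (w + x) - f w - deriv f w * x) (g' := fun x => deriv f (w + x) - deriv f w)
      (fun t => ?_) (by simp) (fun t => by simpa using T0 _ hf' hb w t) x
    simpa using! ((D f hf w t).sub_const (f w)).sub ((hasDerivAt_id t).const_mul (deriv f w))
  have hf0 := hsm.differentiable (by norm_num)
  have hf1 := hd1.differentiable (by norm_num)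
  have hf2 := hd2.differentiable (by norm_num)
  refine ⟨φ, deriv φ, deriv (deriv φ), K, ⟨fun x => Real.smoothTransition.nonneg _,
    fun x => Real.smoothTransition.le_one _, fun x => hanti.deriv_nonpos, k1, k2,
    T0 φ hf0 k1, T1 φ hf0 hf1 k2, fun w x => ?_⟩, hsm.continuous, h1, h0⟩
  refine abs_le_mul_abs_pow_succ_of_deriv hK (n := 2)
    (g := fun x => φ (w + x) - φ w - deriv φ w * x - deriv (deriv φ) w / 2 * x ^ 2)
    (g' := fun x => deriv φ (w + x) - deriv φ w - deriv (deriv φ) w * x)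
    (fun t => ?_) (by simp) (fun t => T1 _ hf1 hf2 k3 w t) x
  convert! (((D φ hf0 w t).sub_const (φ w)).sub ((hasDerivAt_id t).const_mul (deriv φ w))).sub
    (((hasDerivAt_id t).pow 2).const_mul (deriv (deriv φ) w / 2)) using 1
  simp; ring

/-- Second order expansion of the product `∏ φ(wᵢ)`, with mixed second order coefficients that
are nonnegative and an error of third order. -/
theorem IsSmoothStep.exists_prod_expansion {ι : Type*} [Fintype ι] {φ φ₁ φ₂ : ℝ → ℝ} {K : ℝ}
    (h : IsSmoothStep φ φ₁ φ₂ K) (s : Finset ι) :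
    ∃ (C : ℝ) (b : (ι → ℝ) → ι → ℝ) (c : (ι → ℝ) → ι → ι → ℝ), 0 ≤ C ∧
      (∀ w i, b w i ≤ 0) ∧ (∀ w i, |b w i| ≤ C) ∧
      (∀ w i j, i ≠ j → 0 ≤ c w i j) ∧ (∀ w i j, |c w i j| ≤ C) ∧
      ∀ w x : ι → ℝ, |∏ i ∈ s, φ (w i + x i) - ∏ i ∈ s, φ (w i) - ∑ i, b w i * x i
        - ∑ i, ∑ j, c w i j * (x i * x j)| ≤ C * (∑ i, |x i|) ^ 3 := by
  classical
  have hK : 0 ≤ K := (abs_nonneg _).trans (h.abs_deriv_le 0)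
  have hφ1 : ∀ x, |φ x| ≤ 1 := fun x => by
    rw [abs_of_nonneg (h.nonneg x)]; exact h.le_one x
  induction s using Finset.induction_on with
  | empty => exact ⟨0, 0, 0, le_rfl, by simp, by simp, by simp, by simp, by simp⟩
  | insert k s hk ih =>
    obtain ⟨C, b, c, hC, hb0, hbC, hc0, hcC, hE⟩ := ih
    have ha0 : ∀ w : ι → ℝ, 0 ≤ ∏ i ∈ s, φ (w i) := fun w =>
      Finset.prod_nonneg fun i _ => h.nonneg _
    have ha1 : ∀ w : ι → ℝ, ∏ i ∈ s, φ (w i) ≤ 1 := fun w =>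
      Finset.prod_le_one (fun i _ => h.nonneg _) fun i _ => h.le_one _
    have ha : ∀ w : ι → ℝ, |∏ i ∈ s, φ (w i)| ≤ 1 := fun w => by
      rw [abs_of_nonneg (ha0 w)]; exact ha1 w
    -- The coefficients come from multiplying the two Taylor expansions. The new mixed coefficient
    -- is `φ₁ (w k) * b w j`, a product of two nonpositive numbers, which is why the sign of `b` is
    -- part of the induction.
    refine ⟨(C + K + K * C + K * C) + (C + K + K * C + K * C),
      fun w i => φ (w k) * b w i + if i = k then φ₁ (w k) * ∏ i ∈ s, φ (w i) else 0,
      fun w i j => φ (w k) * c w i j + (if i = k then φ₁ (w k) * b w j else 0) +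
        if i = k then (if j = k then φ₂ (w k) / 2 * ∏ i ∈ s, φ (w i) else 0) else 0,
      by positivity, ?_, ?_, ?_, ?_, ?_⟩
    · intro w i
      have := mul_nonpos_of_nonneg_of_nonpos (h.nonneg (w k)) (hb0 w i)
      have := mul_nonpos_of_nonpos_of_nonneg (h.deriv_nonpos (w k)) (ha0 w)
      beta_reduce
      split_ifs <;> linarith
    · intro w i
      have e1 : |φ (w k) * b w i| ≤ 1 * C := by
        rw [abs_mul]; gcongr; exacts [hφ1 _, hbC _ _]
      have e2 : |φ₁ (w k) * ∏ i ∈ s, φ (w i)| ≤ K * 1 := by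
        rw [abs_mul]; gcongr; exacts [h.abs_deriv_le _, ha _]
      have := mul_nonneg hK hC
      refine (abs_add_le _ _).trans ?_
      split_ifs
      · linarith
      · rw [abs_zero]; linarith
    · intro w i j hij
      have e1 := mul_nonneg (h.nonneg (w k)) (hc0 w i j hij)
      have e2 := mul_nonneg_of_nonpos_of_nonpos (h.deriv_nonpos (w k)) (hb0 w j)
      have : (if i = k then (if j = k then φ₂ (w k) / 2 * ∏ i ∈ s, φ (w i) else 0) else 0) = 0 := by
        split_ifs with h1 h2
        · exact absurd (h1.trans h2.symm) hij
        all_goals rfl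
      beta_reduce
      rw [this]
      split_ifs <;> linarith
    · intro w i j
      have e1 : |φ (w k) * c w i j| ≤ 1 * C := by
        rw [abs_mul]; gcongr; exacts [hφ1 _, hcC _ _ _]
      have e2 : |φ₁ (w k) * b w j| ≤ K * C := by
        rw [abs_mul]; gcongr; exacts [h.abs_deriv_le _, hbC _ _]
      have e3 : |φ₂ (w k) / 2 * ∏ i ∈ s, φ (w i)| ≤ K * 1 := by
        rw [abs_mul]; gcongr
        · rw [abs_div, abs_of_pos (by norm_num : (0:ℝ) < 2)]
          have := h.abs_deriv2_le (w k)
          have := abs_nonneg (φ₂ (w k))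
          linarith
        · exact ha _
      have := mul_nonneg hK hC
      refine (abs_add_le _ _).trans ((add_le_add_left (abs_add_le _ _) _).trans ?_)
      have i1 : |if i = k then φ₁ (w k) * b w j else 0| ≤ K * C := by
        split_ifs
        · exact e2
        · simpa
      have i2 : |if i = k then (if j = k then φ₂ (w k) / 2 * ∏ i ∈ s, φ (w i) else 0) else 0|
          ≤ K * 1 := by
        split_ifs
        · exact e3
        all_goals simpa
      linarith
    · intro w x
      set N := ∑ i, |x i| with hN
      have hN0 : 0 ≤ N := Finset.sum_nonneg fun i _ => abs_nonneg _
      have hxk : |x k| ≤ N := Finset.single_le_sum (f := fun i => |x i|)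
        (fun i _ => abs_nonneg _) (Finset.mem_univ k)
      set q1 := ∑ i, b w i * x i with hq1
      set q2 := ∑ i, ∑ j, c w i j * (x i * x j) with hq2
      set q0 := ∏ i ∈ s, φ (w i) with hq0
      set F := ∏ i ∈ s, φ (w i + x i) with hF
      have hq1b : |q1| ≤ C * N := by
        rw [hN, Finset.mul_sum]
        refine (Finset.abs_sum_le_sum_abs _ _).trans (Finset.sum_le_sum fun i _ => ?_)
        rw [abs_mul]; gcongr; exact hbC _ _
      have hq2b : |q2| ≤ C * N ^ 2 := by
        rw [sq, hN, Finset.sum_mul_sum, Finset.mul_sum]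
        refine (Finset.abs_sum_le_sum_abs _ _).trans (Finset.sum_le_sum fun i _ => ?_)
        rw [Finset.mul_sum]
        refine (Finset.abs_sum_le_sum_abs _ _).trans (Finset.sum_le_sum fun j _ => ?_)
        rw [abs_mul, abs_mul]; gcongr; exact hcC _ _ _
      have s1 : ∑ i, (φ (w k) * b w i + if i = k then φ₁ (w k) * q0 else 0) * x i
          = φ (w k) * q1 + φ₁ (w k) * x k * q0 := by
        simp only [add_mul, Finset.sum_add_distrib, ite_mul, zero_mul, Finset.sum_ite_eq',
          Finset.mem_univ, if_true, hq1, Finset.mul_sum]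
        congr 1
        · exact Finset.sum_congr rfl fun i _ => by ring
        · ring
      have s2 : ∑ i, ∑ j, (φ (w k) * c w i j + (if i = k then φ₁ (w k) * b w j else 0) +
          if i = k then (if j = k then φ₂ (w k) / 2 * q0 else 0) else 0) * (x i * x j)
          = φ (w k) * q2 + φ₁ (w k) * x k * q1 + φ₂ (w k) / 2 * x k ^ 2 * q0 := by
        simp only [add_mul, Finset.sum_add_distrib, hq2, Finset.mul_sum]
        congr 1
        · congr 1
          · exact Finset.sum_congr rfl fun i _ => Finset.sum_congr rfl fun j _ => by ring
          · rw [Finset.sum_eq_single k (fun i _ hi => by simp [hi]) (by simp), hq1,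
              Finset.mul_sum]
            exact Finset.sum_congr rfl fun j _ => by simp; ring
        · rw [Finset.sum_eq_single k (fun i _ hi => by simp [hi]) (by simp),
            Finset.sum_eq_single k (fun i _ hi => by simp [hi]) (by simp)]
          simp; ring
      rw [Finset.prod_insert hk, Finset.prod_insert hk, s1, s2]
      set f := φ (w k + x k)
      have hEw := hE w x
      have t0 := h.taylor0 (w k) (x k)
      have t1 := h.taylor1 (w k) (x k)
      have t2 := h.taylor2 (w k) (x k)
      -- Each term of degree `d` in the old expansion is paired with the Taylor remainder of order
      -- `3 - d` of the new factor, so every summand is cubic in `N`.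
      have id : f * F - φ (w k) * q0 - (φ (w k) * q1 + φ₁ (w k) * x k * q0)
          - (φ (w k) * q2 + φ₁ (w k) * x k * q1 + φ₂ (w k) / 2 * x k ^ 2 * q0)
          = f * (F - q0 - q1 - q2)
            + (f - φ (w k) - φ₁ (w k) * x k - φ₂ (w k) / 2 * x k ^ 2) * q0
            + (f - φ (w k) - φ₁ (w k) * x k) * q1 + (f - φ (w k)) * q2 := by ring
      rw [id]
      have e1 : |f * (F - q0 - q1 - q2)| ≤ 1 * (C * N ^ 3) := by
        rw [abs_mul]; gcongr; exact hφ1 _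
      have e2 : |(f - φ (w k) - φ₁ (w k) * x k - φ₂ (w k) / 2 * x k ^ 2) * q0|
          ≤ K * N ^ 3 * 1 := by
        rw [abs_mul]; gcongr
        · exact t2.trans (by gcongr)
        · exact ha w
      have e3 : |(f - φ (w k) - φ₁ (w k) * x k) * q1| ≤ K * N ^ 2 * (C * N) := by
        rw [abs_mul]; gcongr
        exact t1.trans (by gcongr)
      have e4 : |(f - φ (w k)) * q2| ≤ K * N * (C * N ^ 2) := by
        rw [abs_mul]; gcongr
        exact t0.trans (by gcongr)
      have hT := (abs_add_le (f * (F - q0 - q1 - q2)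
            + (f - φ (w k) - φ₁ (w k) * x k - φ₂ (w k) / 2 * x k ^ 2) * q0
            + (f - φ (w k) - φ₁ (w k) * x k) * q1) ((f - φ (w k)) * q2)).trans
          (add_le_add_left ((abs_add_le _ _).trans (add_le_add_left (abs_add_le _ _) _)) _)
      have : 0 ≤ (C + K + K * C + K * C) * N ^ 3 := by positivity
      nlinarith

/-! ### Gaussian comparison by exchanging increments. -/

section Comparison

variable {ι : Type*} [Fintype ι]

/-- The law of `√s X`, when `μ` is the law of `X`. -/
noncomputable def scaledLaw (s : ℝ) (μ : Measure (ι → ℝ)) : Measure (ι → ℝ) :=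
  μ.map (√s • ContinuousLinearMap.id ℝ (ι → ℝ))

instance (s : ℝ) (μ : Measure (ι → ℝ)) [IsGaussian μ] : IsGaussian (scaledLaw s μ) :=
  isGaussian_map _

theorem IsGaussian.integral_strongDual_eq_zero {μ : Measure (ι → ℝ)} [IsGaussian μ]
    (h0 : ∀ i, ∫ x, x i ∂μ = 0) (L : StrongDual ℝ (ι → ℝ)) : ∫ x, L x ∂μ = 0 := by
  rw [L.integral_comp_id_comm IsGaussian.integrable_id]
  have : ∫ x, x ∂μ = 0 := by
    ext i
    exact (eval_integral (fun i => IsGaussian.integrable_dual μ (.proj i)) i).trans (h0 i)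
  rw [this, map_zero]

theorem charFunDual_scaledLaw {μ : Measure (ι → ℝ)} [IsGaussian μ]
    (h0 : ∀ i, ∫ x, x i ∂μ = 0) {s : ℝ} (hs : 0 ≤ s) (L : StrongDual ℝ (ι → ℝ)) :
    charFunDual (scaledLaw s μ) L = Complex.exp (-(s * Var[L; μ] / 2 : ℝ)) := by
  have hL : L.comp (√s • ContinuousLinearMap.id ℝ (ι → ℝ)) = √s • L := by
    ext; simp
  rw [scaledLaw, charFunDual_map, hL, IsGaussian.charFunDual_eq]
  have h1 : ∫ x, ((√s • L) x : ℂ) ∂μ = 0 := by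
    rw [integral_complex_ofReal, IsGaussian.integral_strongDual_eq_zero h0, Complex.ofReal_zero]
  have h2 : Var[⇑(√s • L); μ] = s * Var[L; μ] := by
    rw [FunLike.coe_smul, variance_smul, Real.sq_sqrt hs]
  rw [h1, h2]
  push_cast
  ring_nf

/-- The semigroup property lets a centered Gaussian vector be cut into independent small copies of
itself, which is what the exchange argument consumes. -/
theorem scaledLaw_add {μ : Measure (ι → ℝ)} [IsGaussian μ] (h0 : ∀ i, ∫ x, x i ∂μ = 0)
    {s t : ℝ} (hs : 0 ≤ s) (ht : 0 ≤ t) :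
    scaledLaw (s + t) μ = scaledLaw s μ ∗ scaledLaw t μ := by
  refine Measure.ext_of_charFunDual ?_
  ext L
  rw [charFunDual_conv, charFunDual_scaledLaw h0 (add_nonneg hs ht),
    charFunDual_scaledLaw h0 hs, charFunDual_scaledLaw h0 ht, ← Complex.exp_add]
  push_cast
  ring_nf

omit [Fintype ι] in
theorem scaledLaw_zero (μ : Measure (ι → ℝ)) [IsProbabilityMeasure μ] :
    scaledLaw 0 μ = Measure.dirac 0 := by
  have : ((√0 • ContinuousLinearMap.id ℝ (ι → ℝ) : (ι → ℝ) →L[ℝ] (ι → ℝ)) : (ι → ℝ) → ι → ℝ)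
      = fun _ => 0 := by
    ext; simp
  rw [scaledLaw, this, Measure.map_const]
  simp

omit [Fintype ι] in
theorem scaledLaw_one (μ : Measure (ι → ℝ)) : scaledLaw 1 μ = μ := by
  have : ((√1 • ContinuousLinearMap.id ℝ (ι → ℝ) : (ι → ℝ) →L[ℝ] (ι → ℝ)) : (ι → ℝ) → ι → ℝ)
      = id := by
    ext; simp
  rw [scaledLaw, this, Measure.map_id]

theorem integral_scaledLaw {μ : Measure (ι → ℝ)} (s : ℝ) {f : (ι → ℝ) → ℝ}
    (hf : Continuous f) : ∫ x, f x ∂(scaledLaw s μ) = ∫ x, f (√s • x) ∂μ := by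
  rw [scaledLaw, integral_map (by fun_prop) hf.aestronglyMeasurable]
  rfl

theorem IsGaussian.integrable_eval_mul_eval (μ : Measure (ι → ℝ)) [IsGaussian μ] (i j : ι) :
    Integrable (fun x => x i * x j) μ :=
  (IsGaussian.memLp_dual μ (.proj i) 2 (by simp)).integrable_mul
    (IsGaussian.memLp_dual μ (.proj j) 2 (by simp))

theorem IsGaussian.integrable_sum_abs_pow (μ : Measure (ι → ℝ)) [IsGaussian μ] (n : ℕ) :
    Integrable (fun x : ι → ℝ => (∑ i, |x i|) ^ n) μ := by
  have h : MemLp (fun x : ι → ℝ => ∑ i, |x i|) n μ := by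
    refine memLp_finsetSum _ fun i _ => ?_
    exact (IsGaussian.memLp_dual μ (.proj i) n (by simp)).abs
  refine (h.integrable_norm_pow').congr (ae_of_all _ fun x => ?_)
  beta_reduce
  rw [Real.norm_of_nonneg (Finset.sum_nonneg fun i _ => abs_nonneg _)]

/-- Second order expansion of `𝔼 Φ(w + r X)` for centered Gaussian `X`. -/
theorem abs_integral_sub_le_of_expansion {μ : Measure (ι → ℝ)} [IsGaussian μ]
    (h0 : ∀ i, ∫ x, x i ∂μ = 0) {Φ : (ι → ℝ) → ℝ} (hΦ : Continuous Φ)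
    (hΦ1 : ∀ x, |Φ x| ≤ 1) {C : ℝ} {b : (ι → ℝ) → ι → ℝ}
    {c : (ι → ℝ) → ι → ι → ℝ}
    (hE : ∀ w x : ι → ℝ, |Φ (w + x) - Φ w - ∑ i, b w i * x i
        - ∑ i, ∑ j, c w i j * (x i * x j)| ≤ C * (∑ i, |x i|) ^ 3)
    {r : ℝ} (hr : 0 ≤ r) (w : ι → ℝ) :
    |∫ x, Φ (w + r • x) ∂μ - Φ w - r ^ 2 * ∑ i, ∑ j, c w i j * ∫ x, x i * x j ∂μ|
      ≤ C * r ^ 3 * ∫ x, (∑ i, |x i|) ^ 3 ∂μ := by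
  have iΦ : Integrable (fun x => Φ (w + r • x)) μ :=
    Integrable.of_bound (by fun_prop) 1 (ae_of_all _ fun x => hΦ1 _)
  have ib : ∀ i, Integrable (fun x : ι → ℝ => b w i * (r * x i)) μ := fun i =>
    ((IsGaussian.integrable_dual μ (.proj i)).const_mul r).const_mul _
  have ic : ∀ i j, Integrable (fun x : ι → ℝ => c w i j * ((r * x i) * (r * x j))) μ :=
    fun i j => by
      refine (((IsGaussian.integrable_eval_mul_eval μ i j).const_mul (r ^ 2)).const_mul
        (c w i j)).congr (ae_of_all _ fun x => ?_)
      ring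
  have ibs : Integrable (fun x : ι → ℝ => ∑ i, b w i * (r * x i)) μ :=
    integrable_finsetSum _ fun i _ => ib i
  have ics : Integrable (fun x : ι → ℝ => ∑ i, ∑ j, c w i j * ((r * x i) * (r * x j))) μ :=
    integrable_finsetSum _ fun i _ => integrable_finsetSum _ fun j _ => ic i j
  have e1 : ∫ x, ∑ i, b w i * (r * x i) ∂μ = 0 := by
    rw [integral_finsetSum _ fun i _ => ib i]
    refine Finset.sum_eq_zero fun i _ => ?_
    rw [integral_const_mul, integral_const_mul, h0, mul_zero, mul_zero]
  have e2 : ∫ x, ∑ i, ∑ j, c w i j * ((r * x i) * (r * x j)) ∂μ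
      = r ^ 2 * ∑ i, ∑ j, c w i j * ∫ x, x i * x j ∂μ := by
    rw [integral_finsetSum _ fun i _ => integrable_finsetSum _ fun j _ => ic i j,
      Finset.mul_sum]
    refine Finset.sum_congr rfl fun i _ => ?_
    rw [integral_finsetSum _ fun j _ => ic i j, Finset.mul_sum]
    refine Finset.sum_congr rfl fun j _ => ?_
    rw [integral_const_mul, ← integral_const_mul, ← integral_const_mul, ← integral_const_mul]
    congr 1; ext x; ring
  have key : ∫ x, Φ (w + r • x) ∂μ - Φ w - r ^ 2 * ∑ i, ∑ j, c w i j * ∫ x, x i * x j ∂μ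
      = ∫ x, (Φ (w + r • x) - Φ w - ∑ i, b w i * (r * x i)
        - ∑ i, ∑ j, c w i j * ((r * x i) * (r * x j))) ∂μ := by
    rw [integral_sub _ ics, integral_sub _ ibs, integral_sub iΦ (integrable_const _), e1, e2]
    · simp
    · exact iΦ.sub (integrable_const _)
    · exact (iΦ.sub (integrable_const _)).sub ibs
  rw [key, ← Real.norm_eq_abs, ← integral_const_mul]
  refine norm_integral_le_of_norm_le
    ((IsGaussian.integrable_sum_abs_pow μ 3).const_mul _) (ae_of_all _ fun x => ?_)
  have := hE w (r • x)
  simp only [Pi.smul_apply, smul_eq_mul, abs_mul, abs_of_nonneg hr, ← Finset.mul_sum] at this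
  rw [Real.norm_eq_abs]
  refine this.trans (le_of_eq ?_)
  ring

/-- The amount by which the off-diagonal second moments of `ν` exceed those of `μ`. -/
noncomputable def covExcess (μ ν : Measure (ι → ℝ)) : ℝ :=
  ∑ i, ∑ j, max 0 (∫ x, x i * x j ∂ν - ∫ x, x i * x j ∂μ)

/-- Comparison of `𝔼 Φ(Y)` and `𝔼 Φ(X)` by replacing small Gaussian increments one at a time. -/
theorem integral_le_add_covExcess_of_expansion {μ ν : Measure (ι → ℝ)} [IsGaussian μ]
    [IsGaussian ν] (hμ : ∀ i, ∫ x, x i ∂μ = 0) (hν : ∀ i, ∫ x, x i ∂ν = 0)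
    (hd : ∀ i, ∫ x, x i * x i ∂μ = ∫ x, x i * x i ∂ν) {Φ : (ι → ℝ) → ℝ}
    (hΦ : Continuous Φ) (hΦ1 : ∀ x, |Φ x| ≤ 1) {C : ℝ}
    {b : (ι → ℝ) → ι → ℝ} {c : (ι → ℝ) → ι → ι → ℝ}
    (hc0 : ∀ w i j, i ≠ j → 0 ≤ c w i j) (hcC : ∀ w i j, |c w i j| ≤ C)
    (hE : ∀ w x : ι → ℝ, |Φ (w + x) - Φ w - ∑ i, b w i * x i
        - ∑ i, ∑ j, c w i j * (x i * x j)| ≤ C * (∑ i, |x i|) ^ 3) :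
    ∫ x, Φ x ∂ν ≤ ∫ x, Φ x ∂μ + C * covExcess μ ν := by
  set S := covExcess μ ν with hS
  set B : ℝ := C * ∫ x, (∑ i, |x i|) ^ 3 ∂μ + C * ∫ x, (∑ i, |x i|) ^ 3 ∂ν with hB
  have step : ∀ r : ℝ, 0 ≤ r → ∀ w, ∫ x, Φ (w + r • x) ∂ν ≤
      ∫ x, Φ (w + r • x) ∂μ + (r ^ 2 * (C * S) + B * r ^ 3) := by
    intro r hr w
    have h1 := abs_le.1 (abs_integral_sub_le_of_expansion hμ hΦ hΦ1 hE hr w)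
    have h2 := abs_le.1 (abs_integral_sub_le_of_expansion hν hΦ hΦ1 hE hr w)
    have h3 : ∑ i, ∑ j, c w i j * ∫ x, x i * x j ∂ν - ∑ i, ∑ j, c w i j * ∫ x, x i * x j ∂μ
        ≤ C * S := by
      rw [hS, covExcess, Finset.mul_sum, ← Finset.sum_sub_distrib]
      refine Finset.sum_le_sum fun i _ => ?_
      rw [Finset.mul_sum, ← Finset.sum_sub_distrib]
      refine Finset.sum_le_sum fun j _ => ?_
      rw [← mul_sub]
      -- The diagonal coefficients have no definite sign; equality of variances removes them.
      by_cases hij : i = j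
      · subst hij
        simp [hd]
      · calc c w i j * (∫ x, x i * x j ∂ν - ∫ x, x i * x j ∂μ)
            ≤ c w i j * max 0 (∫ x, x i * x j ∂ν - ∫ x, x i * x j ∂μ) :=
              mul_le_mul_of_nonneg_left (le_max_right _ _) (hc0 w i j hij)
          _ ≤ _ := mul_le_mul_of_nonneg_right ((le_abs_self _).trans (hcC w i j)) (le_max_left _ _)
    have h4 := mul_le_mul_of_nonneg_left h3 (sq_nonneg r)
    rw [mul_sub] at h4
    rw [hB]
    linarith [h1.1, h2.2]
  -- Each of the `n` exchanges costs `δ C S + B δ^(3/2)` with `δ = 1 / n`, so the third-order errors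
  -- total `B √(1 / n)`.
  have main : ∀ n : ℕ, 0 < n →
      ∫ x, Φ x ∂ν ≤ ∫ x, Φ x ∂μ + C * S + B * √(1 / n) := by
    intro n hn
    have hn' : (0 : ℝ) < n := by exact_mod_cast hn
    set δ : ℝ := 1 / n with hδ
    have hδ0 : 0 < δ := by positivity
    -- The interpolating law has `k` increments from `μ` and `n - k` from `ν`, running from `ν` at
    -- `k = 0` to `μ` at `k = n`.
    set h : ℕ → ℝ := fun k =>
      ∫ x, Φ x ∂(scaledLaw (k * δ) μ ∗ scaledLaw ((n - k : ℝ) * δ) ν) with hh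
    have one : ∀ k < n, h k ≤ h (k + 1) + (δ * (C * S) + B * (δ * √δ)) := by
      intro k hk
      have hk' : (0 : ℝ) ≤ n - (k + 1) := by
        rw [sub_nonneg]; exact_mod_cast hk
      set ρ := scaledLaw (k * δ) μ ∗ scaledLaw ((n - (k + 1) : ℝ) * δ) ν with hρ
      have a1 : scaledLaw (k * δ) μ ∗ scaledLaw ((n - k : ℝ) * δ) ν = ρ ∗ scaledLaw δ ν := by
        rw [hρ, Measure.conv_assoc, ← scaledLaw_add hν (by positivity) hδ0.le]
        congr 2; ring
      have a2 : scaledLaw ((k + 1 : ℕ) * δ) μ ∗ scaledLaw ((n - (k + 1 : ℕ) : ℝ) * δ) ν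
          = ρ ∗ scaledLaw δ μ := by
        rw [hρ, Measure.conv_assoc, Measure.conv_comm (scaledLaw ((n - (k + 1) : ℝ) * δ) ν),
          ← Measure.conv_assoc, ← scaledLaw_add hμ (by positivity) hδ0.le]
        push_cast
        congr 2; ring
      have iΦ : ∀ (m : Measure (ι → ℝ)) [IsProbabilityMeasure m], Integrable Φ m := fun m _ =>
        Integrable.of_bound (by fun_prop) 1 (ae_of_all _ fun x => hΦ1 _)
      have ex : ∀ (m : Measure (ι → ℝ)) [IsGaussian m],
          ∫ x, Φ x ∂(ρ ∗ scaledLaw δ m) = ∫ w, ∫ x, Φ (w + √δ • x) ∂m ∂ρ := by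
        intro m _
        rw [integral_conv (iΦ _)]
        congr 1; ext w
        exact integral_scaledLaw δ (f := fun x => Φ (w + x)) (by fun_prop)
      have ii : ∀ (m : Measure (ι → ℝ)) [IsGaussian m],
          Integrable (fun w => ∫ x, Φ (w + √δ • x) ∂m) ρ := by
        intro m _
        have : Integrable (fun p : (ι → ℝ) × (ι → ℝ) => Φ (p.1 + √δ • p.2)) (ρ.prod m) :=
          Integrable.of_bound (by fun_prop) 1 (ae_of_all _ fun x => hΦ1 _)
        exact this.integral_prod_left
      simp only [hh]
      rw [a1, a2, ex ν, ex μ]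
      calc ∫ w, ∫ x, Φ (w + √δ • x) ∂ν ∂ρ
          ≤ ∫ w, (∫ x, Φ (w + √δ • x) ∂μ + (δ * (C * S) + B * (δ * √δ))) ∂ρ := by
            refine integral_mono (ii ν) ((ii μ).add (integrable_const _)) fun w => ?_
            have := step (√δ) (Real.sqrt_nonneg _) w
            have e : √δ ^ 3 = δ * √δ := by
              rw [pow_succ, Real.sq_sqrt hδ0.le]
            rwa [Real.sq_sqrt hδ0.le, e] at this
        _ = _ := by
            rw [integral_add (ii μ) (integrable_const _)]
            simp
    have all : ∀ k ≤ n, h 0 ≤ h k + k * (δ * (C * S) + B * (δ * √δ)) := by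
      intro k
      induction k with
      | zero => intro _; simp
      | succ k ih =>
        intro hk
        have := ih (by omega)
        have := one k (by omega)
        push_cast
        linarith
    have hz : h 0 = ∫ x, Φ x ∂ν := by
      simp only [hh]
      rw [show ((0 : ℕ) : ℝ) * δ = 0 by simp, show ((n : ℝ) - (0 : ℕ)) * δ = 1 by
        rw [hδ]; field_simp; simp, scaledLaw_zero, scaledLaw_one, Measure.dirac_zero_conv]
    have hon : h n = ∫ x, Φ x ∂μ := by
      simp only [hh]
      rw [show ((n : ℝ) - n) * δ = 0 by simp, show (n : ℝ) * δ = 1 by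
        rw [hδ]; field_simp, scaledLaw_zero, scaledLaw_one, Measure.conv_dirac_zero]
    have := all n le_rfl
    rw [hz, hon] at this
    refine this.trans (le_of_eq ?_)
    have hnδ : (n : ℝ) * δ = 1 := by rw [hδ]; field_simp
    linear_combination (C * S + B * √δ) * hnδ
  have lim : Tendsto (fun n : ℕ => ∫ x, Φ x ∂μ + C * S + B * √(1 / n)) atTop
      (𝓝 (∫ x, Φ x ∂μ + C * S + B * √0)) := by
    refine Tendsto.const_add _ (Tendsto.const_mul _ ?_)
    exact (Real.continuous_sqrt.tendsto 0).comp tendsto_one_div_atTop_nhds_zero_nat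
  rw [Real.sqrt_zero, mul_zero, add_zero] at lim
  refine ge_of_tendsto lim ?_
  filter_upwards [eventually_gt_atTop 0] with n hn using main n hn

/-- A quantitative form of Slepian's inequality, for centered Gaussian laws with equal
variances. -/
theorem exists_measureReal_forall_le_le_add_covExcess (ι : Type*) [Fintype ι] {a b : ℝ}
    (hab : a < b) : ∃ C : ℝ, 0 ≤ C ∧ ∀ μ ν : Measure (ι → ℝ), IsGaussian μ → IsGaussian ν →
      (∀ i, ∫ x, x i ∂μ = 0) → (∀ i, ∫ x, x i ∂ν = 0) →
      (∀ i, ∫ x, x i * x i ∂μ = ∫ x, x i * x i ∂ν) →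
      ν.real {x | ∀ i, x i ≤ a} ≤ μ.real {x | ∀ i, x i < b} + C * covExcess μ ν := by
  obtain ⟨φ, φ₁, φ₂, K, h, hcont, h1, h0⟩ := exists_isSmoothStep hab
  obtain ⟨C, β, c, hC, -, -, hc0, hcC, hE⟩ := h.exists_prod_expansion (Finset.univ : Finset ι)
  refine ⟨C, hC, fun μ ν _ _ hμ hν hd => ?_⟩
  -- `Φ` lies between the indicators of the two orthants; the gap between `a` and `b` is what leaves
  -- room for a smooth step.
  set Φ : (ι → ℝ) → ℝ := fun x => ∏ i, φ (x i) with hΦ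
  have hΦc : Continuous Φ := by fun_prop
  have hΦ0 : ∀ x, 0 ≤ Φ x := fun x => Finset.prod_nonneg fun i _ => h.nonneg _
  have hΦ1 : ∀ x, Φ x ≤ 1 := fun x =>
    Finset.prod_le_one (fun i _ => h.nonneg _) fun i _ => h.le_one _
  have hΦa : ∀ x, |Φ x| ≤ 1 := fun x => by rw [abs_of_nonneg (hΦ0 x)]; exact hΦ1 x
  have main := integral_le_add_covExcess_of_expansion hμ hν hd hΦc hΦa hc0 hcC hE
  have iΦ : ∀ (m : Measure (ι → ℝ)) [IsProbabilityMeasure m], Integrable Φ m := fun m _ =>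
    Integrable.of_bound (by fun_prop) 1 (ae_of_all _ fun x => hΦa _)
  have mA : MeasurableSet {x : ι → ℝ | ∀ i, x i ≤ a} := by
    simp only [Set.ofPred_forall]
    exact MeasurableSet.iInter fun i => measurableSet_le (by fun_prop) (by fun_prop)
  have mB : MeasurableSet {x : ι → ℝ | ∀ i, x i < b} := by
    simp only [Set.ofPred_forall]
    exact MeasurableSet.iInter fun i => measurableSet_lt (by fun_prop) (by fun_prop)
  have l1 : ν.real {x | ∀ i, x i ≤ a} ≤ ∫ x, Φ x ∂ν := by
    rw [← integral_indicator_one mA]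
    refine integral_mono ((integrable_const (1 : ℝ)).indicator mA) (iΦ ν) fun x => ?_
    by_cases hx : x ∈ {x : ι → ℝ | ∀ i, x i ≤ a}
    · rw [Set.indicator_of_mem hx]
      refine le_of_eq (Eq.symm ?_)
      exact Finset.prod_eq_one fun i _ => h1 _ (hx i)
    · rw [Set.indicator_of_notMem hx]; exact hΦ0 x
  have l2 : ∫ x, Φ x ∂μ ≤ μ.real {x | ∀ i, x i < b} := by
    rw [← integral_indicator_one mB]
    refine integral_mono (iΦ μ) ((integrable_const (1 : ℝ)).indicator mB) fun x => ?_
    by_cases hx : x ∈ {x : ι → ℝ | ∀ i, x i < b}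
    · rw [Set.indicator_of_mem hx]; exact hΦ1 x
    · rw [Set.indicator_of_notMem hx]
      simp only [Set.mem_ofPred_eq, not_forall, not_lt] at hx
      obtain ⟨i, hi⟩ := hx
      exact le_of_eq (Finset.prod_eq_zero (Finset.mem_univ i) (h0 _ hi))
  linarith

end Comparison

theorem mem_timeDomain_of_le {T : ℝ≥0∞} {s t : ℝ≥0} (hst : s ≤ t) (ht : t ∈ timeDomain T) :
    s ∈ timeDomain T :=
  le_trans (ENNReal.coe_le_coe.2 hst) ht

/-! ### Moments and finite-dimensional laws of the processes. -/

section GaussianOn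

variable {Ω : Type*} [MeasurableSpace Ω] {P : Measure Ω} {J : Set ℝ≥0} {X : ℝ≥0 → Ω → ℝ}
  {A : ℝ≥0 → ℝ≥0 → ℝ}

theorem IsGaussianWithCorrelationOn.isProbabilityMeasure
    (h : IsGaussianWithCorrelationOn P J X A) : IsProbabilityMeasure P :=
  h.gaussian.isProbabilityMeasure

theorem IsGaussianWithCorrelationOn.aemeasurable (h : IsGaussianWithCorrelationOn P J X A)
    {t : ℝ≥0} (ht : t ∈ J) : AEMeasurable (X t) P :=
  h.gaussian.aemeasurable ⟨t, ht⟩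

theorem IsGaussianWithCorrelationOn.memLp_two (h : IsGaussianWithCorrelationOn P J X A)
    {t : ℝ≥0} (ht : t ∈ J) : MemLp (X t) 2 P :=
  (h.gaussian.hasGaussianLaw_eval ⟨t, ht⟩).memLp_two

theorem IsGaussianWithCorrelationOn.integral_mul (h : IsGaussianWithCorrelationOn P J X A)
    {s t : ℝ≥0} (hs : s ∈ J) (ht : t ∈ J) : ∫ ω, X s ω * X t ω ∂P = A s t := by
  have := h.isProbabilityMeasure
  have e := covariance_eq_sub (h.memLp_two hs) (h.memLp_two ht)
  rw [h.correlation s hs t ht, h.centered s hs, zero_mul, sub_zero] at e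
  exact e.symm

theorem IsGaussianWithCorrelationOn.diag (h : IsGaussianWithCorrelationOn P J X A)
    {t : ℝ≥0} (ht : t ∈ J) : A t t = 1 := by
  rw [← h.integral_mul ht ht, ← h.normalized t ht]
  simp only [sq]

theorem IsGaussianWithCorrelationOn.symm (h : IsGaussianWithCorrelationOn P J X A)
    {s t : ℝ≥0} (hs : s ∈ J) (ht : t ∈ J) : A s t = A t s := by
  rw [← h.integral_mul hs ht, ← h.integral_mul ht hs]
  simp only [mul_comm]

theorem IsGaussianWithCorrelationOn.integral_sub_sq (h : IsGaussianWithCorrelationOn P J X A)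
    {s t : ℝ≥0} (hs : s ∈ J) (ht : t ∈ J) :
    ∫ ω, (X s ω - X t ω) ^ 2 ∂P = 2 - 2 * A s t := by
  have is := (h.memLp_two hs).integrable_sq
  have it := (h.memLp_two ht).integrable_sq
  have ist : Integrable (fun ω => X s ω * X t ω) P :=
    (h.memLp_two hs).integrable_mul (h.memLp_two ht)
  have iadd : Integrable (fun ω => X s ω ^ 2 + X t ω ^ 2) P := is.add it
  have e : ∀ ω, (X s ω - X t ω) ^ 2 = X s ω ^ 2 + X t ω ^ 2 - 2 * (X s ω * X t ω) := fun ω => by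
    ring
  simp only [e]
  rw [integral_sub iadd (ist.const_mul 2), integral_add is it, integral_const_mul,
    h.normalized s hs, h.normalized t ht, h.integral_mul hs ht]
  ring

theorem IsGaussianWithCorrelationOn.abs_le_one (h : IsGaussianWithCorrelationOn P J X A)
    {s t : ℝ≥0} (hs : s ∈ J) (ht : t ∈ J) : A s t ≤ 1 ∧ -1 ≤ A s t := by
  have is := (h.memLp_two hs).integrable_sq
  have it := (h.memLp_two ht).integrable_sq
  have ist : Integrable (fun ω => X s ω * X t ω) P :=
    (h.memLp_two hs).integrable_mul (h.memLp_two ht)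
  have iadd : Integrable (fun ω => X s ω ^ 2 + X t ω ^ 2) P := is.add it
  constructor
  · have := integral_nonneg (μ := P) (f := fun ω => (X s ω - X t ω) ^ 2) fun ω => sq_nonneg _
    rw [h.integral_sub_sq hs ht] at this
    linarith
  · have := integral_nonneg (μ := P) (f := fun ω => (X s ω + X t ω) ^ 2) fun ω => sq_nonneg _
    have e : ∀ ω, (X s ω + X t ω) ^ 2 = X s ω ^ 2 + X t ω ^ 2 + 2 * (X s ω * X t ω) := fun ω => by
      ring
    simp only [e] at this
    rw [integral_add iadd (ist.const_mul 2), integral_add is it, integral_const_mul,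
      h.normalized s hs, h.normalized t ht, h.integral_mul hs ht] at this
    linarith

theorem IsGaussianWithCorrelationOn.mono (h : IsGaussianWithCorrelationOn P J X A)
    {J' : Set ℝ≥0} (hJ : J' ⊆ J) : IsGaussianWithCorrelationOn P J' X A where
  gaussian := h.gaussian.comp_right fun t : J' => (⟨t, hJ t.2⟩ : J)
  centered t ht := h.centered t (hJ ht)
  normalized t ht := h.normalized t (hJ ht)
  correlation s hs t ht := h.correlation s (hJ hs) t (hJ ht)

theorem IsGaussianWithCorrelationOn.shift (h : IsGaussianWithCorrelationOn P J X A)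
    {J' : Set ℝ≥0} (s : ℝ≥0) (hJ : ∀ t ∈ J', s + t ∈ J) :
    IsGaussianWithCorrelationOn P J' (fun t => X (s + t)) fun t u => A (s + t) (s + u) where
  gaussian := h.gaussian.comp_right fun t : J' => (⟨s + t, hJ t t.2⟩ : J)
  centered t ht := h.centered _ (hJ t ht)
  normalized t ht := h.normalized _ (hJ t ht)
  correlation t ht u hu := h.correlation _ (hJ t ht) _ (hJ u hu)

/-- The joint law of the values at a finite set of times. -/
noncomputable def finiteDimLaw (P : Measure Ω) (X : ℝ≥0 → Ω → ℝ) (F : Finset ℝ≥0) :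
    Measure (F → ℝ) :=
  P.map fun ω i => X i ω

theorem IsGaussianWithCorrelationOn.hasGaussianLaw (h : IsGaussianWithCorrelationOn P J X A)
    {F : Finset ℝ≥0} (hF : ∀ t ∈ F, t ∈ J) : HasGaussianLaw (fun ω (i : F) => X i ω) P := by
  have := (h.gaussian.comp_right fun t : F => (⟨t, hF t t.2⟩ : J)).hasGaussianLaw Finset.univ
  exact this.map (ContinuousLinearMap.pi fun t : F => ContinuousLinearMap.proj
    (⟨t, Finset.mem_univ t⟩ : (Finset.univ : Finset F)))

theorem IsGaussianWithCorrelationOn.integral_finiteDimLaw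
    (h : IsGaussianWithCorrelationOn P J X A) {F : Finset ℝ≥0} (hF : ∀ t ∈ F, t ∈ J) (i : F) :
    ∫ x, x i ∂(finiteDimLaw P X F) = 0 := by
  rw [finiteDimLaw, integral_map (h.hasGaussianLaw hF).aemeasurable
    (measurable_pi_apply i).aestronglyMeasurable]
  exact h.centered _ (hF _ i.2)

theorem IsGaussianWithCorrelationOn.integral_mul_finiteDimLaw
    (h : IsGaussianWithCorrelationOn P J X A) {F : Finset ℝ≥0} (hF : ∀ t ∈ F, t ∈ J) (i j : F) :
    ∫ x, x i * x j ∂(finiteDimLaw P X F) = A i j := by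
  rw [finiteDimLaw, integral_map (h.hasGaussianLaw hF).aemeasurable (by fun_prop)]
  exact h.integral_mul (hF _ i.2) (hF _ j.2)

theorem IsGaussianWithCorrelationOn.finiteDimLaw_forall_le
    (h : IsGaussianWithCorrelationOn P J X A) {F : Finset ℝ≥0} (hF : ∀ t ∈ F, t ∈ J) (a : ℝ) :
    finiteDimLaw P X F {x | ∀ i, x i ≤ a} = P {ω | ∀ t ∈ F, X t ω ≤ a} := by
  rw [finiteDimLaw, Measure.map_apply_of_aemeasurable (h.hasGaussianLaw hF).aemeasurable]
  · congr 1; ext ω; simp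
  · simp only [Set.ofPred_forall]
    exact MeasurableSet.iInter fun i => measurableSet_le (by fun_prop) (by fun_prop)

theorem IsGaussianWithCorrelationOn.finiteDimLaw_forall_lt
    (h : IsGaussianWithCorrelationOn P J X A) {F : Finset ℝ≥0} (hF : ∀ t ∈ F, t ∈ J) (a : ℝ) :
    finiteDimLaw P X F {x | ∀ i, x i < a} = P {ω | ∀ t ∈ F, X t ω < a} := by
  rw [finiteDimLaw, Measure.map_apply_of_aemeasurable (h.hasGaussianLaw hF).aemeasurable]
  · congr 1; ext ω; simp
  · simp only [Set.ofPred_forall]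
    exact MeasurableSet.iInter fun i => measurableSet_lt (by fun_prop) (by fun_prop)

end GaussianOn

/-- Quantitative Slepian inequality for the values of two processes at finitely many times. -/
theorem exists_forall_measure_le_add_corr.{u, v} (F : Finset ℝ≥0) {a b : ℝ} (hab : a < b) :
    ∃ C : ℝ, 0 ≤ C ∧ ∀ {Ω : Type u} [MeasurableSpace Ω] {Ω' : Type v} [MeasurableSpace Ω']
      {P : Measure Ω} {Q : Measure Ω'} {J : Set ℝ≥0} {X : ℝ≥0 → Ω → ℝ} {Y : ℝ≥0 → Ω' → ℝ}
      {A B : ℝ≥0 → ℝ≥0 → ℝ}, IsGaussianWithCorrelationOn P J X A →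
      IsGaussianWithCorrelationOn Q J Y B → (∀ t ∈ F, t ∈ J) →
      Q {ω | ∀ t ∈ F, Y t ω ≤ a} ≤ P {ω | ∀ t ∈ F, X t ω < b}
        + ENNReal.ofReal (C * ∑ t ∈ F, ∑ u ∈ F, max 0 (B t u - A t u)) := by
  -- The constant is fixed before the processes are chosen; uniformity in `k` and in the shift
  -- depends on this.
  obtain ⟨C, hC, h⟩ := exists_measureReal_forall_le_le_add_covExcess F hab
  refine ⟨C, hC, ?_⟩
  intro Ω _ Ω' _ P Q J X Y A B hX hY hF
  have := hX.isProbabilityMeasure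
  have := hY.isProbabilityMeasure
  have key := h (finiteDimLaw P X F) (finiteDimLaw Q Y F) (hX.hasGaussianLaw hF).isGaussian_map
    (hY.hasGaussianLaw hF).isGaussian_map (hX.integral_finiteDimLaw hF)
    (hY.integral_finiteDimLaw hF) fun i => by
      rw [hX.integral_mul_finiteDimLaw hF, hY.integral_mul_finiteDimLaw hF,
        hX.diag (hF _ i.2), hY.diag (hF _ i.2)]
  have e : covExcess (finiteDimLaw P X F) (finiteDimLaw Q Y F)
      = ∑ t ∈ F, ∑ u ∈ F, max 0 (B t u - A t u) := by
    simp only [covExcess, hX.integral_mul_finiteDimLaw hF, hY.integral_mul_finiteDimLaw hF]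
    rw [← Finset.sum_coe_sort F fun t => ∑ u ∈ F, max 0 (B t u - A t u)]
    refine Finset.sum_congr rfl fun i _ => ?_
    exact Finset.sum_coe_sort F fun u => max 0 (B i u - A i u)
  rw [e, measureReal_def, measureReal_def, hX.finiteDimLaw_forall_lt hF,
    hY.finiteDimLaw_forall_le hF] at key
  have h0 : 0 ≤ C * ∑ t ∈ F, ∑ u ∈ F, max 0 (B t u - A t u) :=
    mul_nonneg hC (Finset.sum_nonneg fun _ _ => Finset.sum_nonneg fun _ _ => le_max_left _ _)
  rw [← ENNReal.ofReal_toReal (measure_ne_top Q _),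
    ← ENNReal.ofReal_toReal (measure_ne_top P {ω | ∀ t ∈ F, X t ω < b}),
    ← ENNReal.ofReal_add ENNReal.toReal_nonneg h0]
  exact ENNReal.ofReal_le_ofReal key

/-- **Slepian's inequality** at finitely many times. -/
theorem measure_forall_le_le_measure_forall_lt_of_corr_le {Ω Ω' : Type*} [MeasurableSpace Ω]
    [MeasurableSpace Ω'] {P : Measure Ω} {Q : Measure Ω'} {J : Set ℝ≥0} {X : ℝ≥0 → Ω → ℝ}
    {Y : ℝ≥0 → Ω' → ℝ} {A B : ℝ≥0 → ℝ≥0 → ℝ} (hX : IsGaussianWithCorrelationOn P J X A)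
    (hY : IsGaussianWithCorrelationOn Q J Y B) {F : Finset ℝ≥0} (hF : ∀ t ∈ F, t ∈ J)
    (hAB : ∀ t ∈ F, ∀ u ∈ F, t ≤ u → B t u ≤ A t u) {a b : ℝ} (hab : a < b) :
    Q {ω | ∀ t ∈ F, Y t ω ≤ a} ≤ P {ω | ∀ t ∈ F, X t ω < b} := by
  obtain ⟨C, hC, h⟩ := exists_forall_measure_le_add_corr F hab
  refine (h hX hY hF).trans (le_of_eq ?_)
  rw [Finset.sum_eq_zero, mul_zero, ENNReal.ofReal_zero, add_zero]
  intro t ht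
  refine Finset.sum_eq_zero fun u hu => max_eq_left (sub_nonpos.2 ?_)
  rcases le_total t u with htu | htu
  · exact hAB t ht u hu htu
  · rw [hX.symm (hF t ht) (hF u hu), hY.symm (hF t ht) (hF u hu)]
    exact hAB u hu t ht htu

/-! ### Separability and suprema over windows. -/

section Separable

variable {Ω : Type*} [MeasurableSpace Ω] {P : Measure Ω} {J : Set ℝ≥0} {X : ℝ≥0 → Ω → ℝ}

/-- Restricting a separating set to a window can lose the endpoints, whose approximating points may
lie outside it. The endpoints are therefore adjoined. -/
theorem IsSeparableOn.shift (h : IsSeparableOn P J X) (s M : ℝ≥0)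
    (hJ : ∀ t ≤ M, s + t ∈ J) : IsSeparableOn P (Set.Iic M) fun t => X (s + t) := by
  obtain ⟨S, -, hSc, hS⟩ := h
  refine ⟨{t | t ≤ M ∧ (s + t ∈ S ∨ t = 0 ∨ t = M)}, fun t ht => ht.1, ?_, ?_⟩
  · have : {t : ℝ≥0 | t ≤ M ∧ (s + t ∈ S ∨ t = 0 ∨ t = M)}
        ⊆ ((fun t => s + t) ⁻¹' S) ∪ {0, M} := fun t ht => by
      rcases ht.2 with h | h | h <;> simp [h]
    refine Set.Countable.mono this (Set.Countable.union ?_ (Set.toFinite _).countable)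
    exact hSc.preimage (add_right_injective s)
  · filter_upwards [hS] with ω hω t ht
    by_cases h0 : t = 0
    · exact subset_closure ⟨t, ⟨ht, Or.inr (Or.inl h0)⟩, rfl⟩
    by_cases hM : t = M
    · exact subset_closure ⟨t, ⟨ht, Or.inr (Or.inr hM)⟩, rfl⟩
    have hlt : t < M := lt_of_le_of_ne ht hM
    have hpos : 0 < t := pos_iff_ne_zero.2 h0
    have hcl := hω (s + t) (hJ t ht)
    -- At an interior time the approximating points can be forced into the open window. There `r >
    -- s`, so the truncated subtraction `r - s` is exact.
    have hI : Set.Ioo s (s + M) ×ˢ (Set.univ : Set ℝ) ∈ 𝓝 (s + t, X (s + t) ω) := by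
      refine prod_mem_nhds (Ioo_mem_nhds ?_ ?_) univ_mem
      · exact lt_add_of_pos_right s hpos
      · gcongr
    have hcl' := mem_closure_iff_nhds.1 hcl
    rw [mem_closure_iff_nhds]
    intro U hU
    have hcont : Continuous fun p : ℝ≥0 × ℝ => (p.1 - s, p.2) := by fun_prop
    have hU' : (fun p : ℝ≥0 × ℝ => (p.1 - s, p.2)) ⁻¹' U ∈ 𝓝 (s + t, X (s + t) ω) := by
      apply hcont.continuousAt
      simpa using hU
    obtain ⟨p, ⟨hp1, hp2⟩, r, hr, rfl⟩ := hcl' _ (inter_mem hU' hI)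
    have hr2 : s < r ∧ r < s + M := by simpa using hp2
    have hrs : s + (r - s) = r := add_tsub_cancel_of_le hr2.1.le
    refine ⟨(r - s, X r ω), hp1, r - s, ⟨?_, Or.inl (by rwa [hrs])⟩, by simp only [hrs]⟩
    exact (tsub_lt_iff_left hr2.1.le).2 hr2.2 |>.le

/-- A countable set of times in `[0, M]` determines the supremum over `[0, M]`. -/
theorem IsSeparableOn.exists_countable_forall_le {M : ℝ≥0} (h : IsSeparableOn P (Set.Iic M) X) :
    ∃ S : Set ℝ≥0, S ⊆ Set.Iic M ∧ S.Countable ∧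
      ∀ᵐ ω ∂P, ∀ c : ℝ, (∀ t ∈ S, X t ω ≤ c) → ∀ t ≤ M, X t ω ≤ c := by
  obtain ⟨S, hSM, hSc, hS⟩ := h
  refine ⟨S, hSM, hSc, ?_⟩
  filter_upwards [hS] with ω hω c hc t ht
  have hcl : IsClosed {p : ℝ≥0 × ℝ | p.2 ≤ c} := isClosed_le continuous_snd continuous_const
  exact (closure_minimal (by rintro _ ⟨r, hr, rfl⟩; exact hc r hr) hcl) (hω t ht)

end Separable

theorem pathSup_shift {Ω : Type*} (X : ℝ≥0 → Ω → ℝ) (s M : ℝ≥0) (ω : Ω) :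
    pathSup (fun t => X (s + t)) 0 M ω = pathSup X s M ω := by
  simp [pathSup]

theorem pathSup_le_iff {Ω : Type*} {X : ℝ≥0 → Ω → ℝ} {M : ℝ≥0} {ω : Ω} {c : ℝ} :
    pathSup X 0 M ω ≤ c ↔ ∀ t ≤ M, X t ω ≤ c := by
  simp [pathSup]

theorem pathSup_lt_iff {Ω : Type*} {X : ℝ≥0 → Ω → ℝ} {M : ℝ≥0} {ω : Ω} {z : ℝ} :
    pathSup X 0 M ω < z ↔ ∃ c < z, ∀ t ≤ M, X t ω ≤ c := by
  constructor
  · intro h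
    obtain ⟨c, hc1, hc2⟩ := EReal.lt_iff_exists_real_btwn.1 h
    exact ⟨c, by exact_mod_cast hc2, pathSup_le_iff.1 hc1.le⟩
  · rintro ⟨c, hc, h⟩
    exact lt_of_le_of_lt (pathSup_le_iff.2 h) (by exact_mod_cast hc)

section SupLimits

variable {Ω : Type*} [MeasurableSpace Ω] {P : Measure Ω} {X : ℝ≥0 → Ω → ℝ}

/-- The supremum over `[0, M]` is almost surely determined by an increasing sequence of finite
sets of times. -/
theorem IsSeparableOn.exists_finset_seq {M : ℝ≥0} (h : IsSeparableOn P (Set.Iic M) X) :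
    ∃ F : ℕ → Finset ℝ≥0, Monotone F ∧ (∀ n, ∀ t ∈ F n, t ∈ Set.Iic M) ∧
      ∀ᵐ ω ∂P, ∀ c : ℝ, (∀ n, ∀ t ∈ F n, X t ω ≤ c) → ∀ t ≤ M, X t ω ≤ c := by
  classical
  obtain ⟨S, hSM, hSc, hS⟩ := h.exists_countable_forall_le
  -- Adjoining `0`, which lies in every window, makes the countable set nonempty and hence the range
  -- of a sequence.
  obtain ⟨f, hf⟩ := (hSc.insert 0).exists_eq_range (Set.insert_nonempty _ _)
  refine ⟨fun n => (Finset.range n).image f, fun m n hmn => ?_, fun n t ht => ?_, ?_⟩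
  · exact Finset.image_subset_image (Finset.range_subset_range.2 hmn)
  · obtain ⟨i, -, rfl⟩ := Finset.mem_image.1 ht
    have : f i ∈ insert 0 S := by rw [hf]; exact Set.mem_range_self i
    rcases this with h | h
    · simp [h]
    · exact hSM h
  · filter_upwards [hS] with ω hω c hc
    refine hω c fun t ht => ?_
    have : t ∈ Set.range f := by rw [← hf]; exact Set.mem_insert_of_mem _ ht
    obtain ⟨i, rfl⟩ := this
    exact hc (i + 1) _ (Finset.mem_image_of_mem f (Finset.self_mem_range_succ i))

theorem nullMeasurableSet_forall_mem_finset_le {F : Finset ℝ≥0}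
    (hX : ∀ t ∈ F, AEMeasurable (X t) P) (c : ℝ) :
    NullMeasurableSet {ω | ∀ t ∈ F, X t ω ≤ c} P := by
  have : {ω | ∀ t ∈ F, X t ω ≤ c} = ⋂ t ∈ F, {ω | X t ω ≤ c} := by ext; simp
  rw [this]
  exact F.nullMeasurableSet_biInter fun t ht => nullMeasurableSet_le (hX t ht) aemeasurable_const

/-- With slack `1 / (n + 1)` on the `n`-th finite set, the events decrease to one that forces `X ≤
z` on the separating set, hence on the whole window. Continuity from above concludes. -/
theorem le_measure_pathSup_le_of_forall_finset [IsFiniteMeasure P] {M : ℝ≥0}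
    (h : IsSeparableOn P (Set.Iic M) X) (hX : ∀ t ≤ M, AEMeasurable (X t) P) {z : ℝ} {m : ℝ≥0∞}
    (hm : ∀ F : Finset ℝ≥0, (∀ t ∈ F, t ∈ Set.Iic M) → ∀ η > 0,
      m ≤ P {ω | ∀ t ∈ F, X t ω ≤ z + η}) :
    m ≤ P {ω | pathSup X 0 M ω ≤ z} := by
  obtain ⟨F, hFm, hFM, hF⟩ := h.exists_finset_seq
  have lim := tendsto_measure_iInter_atTop (μ := P)
    (s := fun n : ℕ => {ω | ∀ t ∈ F n, X t ω ≤ z + 1 / ((n : ℝ) + 1)})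
    (fun n => nullMeasurableSet_forall_mem_finset_le (fun t ht => hX t (hFM n t ht)) _)
    (fun a b hab ω hω t ht => (hω t (hFm hab ht)).trans (by
      have : (a : ℝ) ≤ b := by exact_mod_cast hab
      gcongr)) ⟨0, measure_ne_top _ _⟩
  refine (ge_of_tendsto' lim fun n => hm _ (hFM n) _ (by positivity)).trans ?_
  refine measure_mono_ae ?_
  filter_upwards [hF] with ω hω hmem
  refine pathSup_le_iff.2 (hω z fun n t ht => ?_)
  have hmem' : ∀ k, ∀ t ∈ F k, X t ω ≤ z + 1 / ((k : ℝ) + 1) := by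
    simpa using! Set.mem_iInter.1 hmem
  have l2 : Tendsto (fun k : ℕ => z + 1 / ((k : ℝ) + 1)) atTop (𝓝 (z + 0)) :=
    tendsto_one_div_add_atTop_nhds_zero_nat.const_add z
  rw [add_zero] at l2
  refine ge_of_tendsto l2 ?_
  filter_upwards [eventually_ge_atTop n] with k hk using hmem' k t (hFm hk ht)

/-- A supremum below `z` leaves a gap, so the event is covered by an increasing union of weak
inequalities. Continuity from below along a monotone union needs no measurability of these events.
-/
theorem measure_pathSup_lt_le_of_forall_le {M : ℝ≥0} {z : ℝ} {m : ℝ≥0∞}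
    (hm : ∀ c < z, P {ω | pathSup X 0 M ω ≤ c} ≤ m) : P {ω | pathSup X 0 M ω < z} ≤ m := by
  have e : {ω | pathSup X 0 M ω < z} ⊆ ⋃ n : ℕ,
      {ω | pathSup X 0 M ω ≤ ((z - 1 / ((n : ℝ) + 1) : ℝ) : EReal)} := by
    intro ω hω
    obtain ⟨c, hc, h⟩ := pathSup_lt_iff.1 hω
    obtain ⟨n, hn⟩ := exists_nat_one_div_lt (sub_pos.2 hc)
    exact Set.mem_iUnion.2 ⟨n, pathSup_le_iff.2 fun t ht => (h t ht).trans (by linarith)⟩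
  have hmono : Monotone fun n : ℕ =>
      {ω | pathSup X 0 M ω ≤ ((z - 1 / ((n : ℝ) + 1) : ℝ) : EReal)} := by
    intro a b hab ω hω
    refine le_trans (show pathSup X 0 M ω ≤ _ from hω) ?_
    have : (a : ℝ) ≤ b := by exact_mod_cast hab
    exact_mod_cast (by gcongr : z - 1 / ((a : ℝ) + 1) ≤ z - 1 / ((b : ℝ) + 1))
  refine (measure_mono e).trans ?_
  rw [hmono.measure_iUnion]
  exact iSup_le fun n => hm _ (by
    have : 0 < 1 / ((n : ℝ) + 1) := by positivity
    linarith)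

theorem le_measure_pathSup_lt_of_forall_finset [IsFiniteMeasure P] {M : ℝ≥0}
    (h : IsSeparableOn P (Set.Iic M) X) (hX : ∀ t ≤ M, AEMeasurable (X t) P) {b z : ℝ}
    (hbz : b < z) {m : ℝ≥0∞} (hm : ∀ F : Finset ℝ≥0, (∀ t ∈ F, t ∈ Set.Iic M) →
      m ≤ P {ω | ∀ t ∈ F, X t ω < b}) :
    m ≤ P {ω | pathSup X 0 M ω < z} := by
  refine (le_measure_pathSup_le_of_forall_finset h hX (z := b) fun F hF η hη => ?_).trans
    (measure_mono fun ω hω => lt_of_le_of_lt (show pathSup X 0 M ω ≤ b from hω)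
      (by exact_mod_cast hbz))
  exact (hm F hF).trans (measure_mono fun ω hω t ht => by have := hω t ht; linarith)

theorem exists_nat_measure_lt_abs_lt [IsFiniteMeasure P] {f : Ω → ℝ} (hf : AEMeasurable f P)
    {δ : ℝ≥0∞} (hδ : 0 < δ) : ∃ L : ℕ, P {ω | (L : ℝ) < |f ω|} < δ := by
  have lim := tendsto_measure_iInter_atTop (μ := P) (s := fun n : ℕ => {ω | (n : ℝ) < |f ω|})
    (fun n => nullMeasurableSet_lt aemeasurable_const hf.abs)
    (fun a b hab ω hω => lt_of_le_of_lt (by exact_mod_cast hab : (a : ℝ) ≤ b) hω)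
    ⟨0, measure_ne_top _ _⟩
  have e : ⋂ n : ℕ, {ω | (n : ℝ) < |f ω|} = ∅ := by
    rw [Set.eq_empty_iff_forall_notMem]
    intro ω hω
    obtain ⟨n, hn⟩ := exists_nat_ge |f ω|
    exact absurd (Set.mem_iInter.1 hω n) (not_lt.2 hn)
  rw [e, measure_empty] at lim
  exact ((tendsto_order.1 lim).2 δ hδ).exists

end SupLimits

/-! ### Independent mixtures of Gaussian processes. -/

section Mixture

theorem ProbabilityTheory.HasGaussianLaw.comp_measurePreserving {Ω Ω' E : Type*}
    [MeasurableSpace Ω] [MeasurableSpace Ω'] {P : Measure Ω} {Q : Measure Ω'}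
    [NormedAddCommGroup E] [NormedSpace ℝ E] [MeasurableSpace E] [BorelSpace E]
    {X : Ω → E} (hX : HasGaussianLaw X P) {f : Ω' → Ω} (hf : MeasurePreserving f Q P) :
    HasGaussianLaw (X ∘ f) Q := by
  refine ⟨?_⟩
  have hm : AEMeasurable X (Q.map f) := by rw [hf.map_eq]; exact hX.aemeasurable
  rw [← AEMeasurable.map_map_of_aemeasurable hm hf.measurable.aemeasurable, hf.map_eq]
  exact hX.isGaussian_map

variable {Ω Ω' : Type*} [MeasurableSpace Ω] [MeasurableSpace Ω'] {P : Measure Ω}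
  {P' : Measure Ω'} {J : Set ℝ≥0} {X : ℝ≥0 → Ω → ℝ} {V : ℝ≥0 → Ω' → ℝ}
  {A D : ℝ≥0 → ℝ≥0 → ℝ}

/-- The independent mixture `√(1 - ε) X + √ε V` has correlation `(1 - ε) A + ε D`. -/
theorem IsGaussianWithCorrelationOn.mixture (hX : IsGaussianWithCorrelationOn P J X A)
    (hV : IsGaussianWithCorrelationOn P' J V D) {ε : ℝ} (h0 : 0 ≤ ε) (h1 : ε ≤ 1) :
    IsGaussianWithCorrelationOn (P.prod P') J
      (fun t p => √(1 - ε) * X t p.1 + √ε * V t p.2)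
      fun s t => (1 - ε) * A s t + ε * D s t := by
  have := hX.isProbabilityMeasure
  have := hV.isProbabilityMeasure
  have mfst : MeasurePreserving Prod.fst (P.prod P') P := measurePreserving_fst
  have msnd : MeasurePreserving Prod.snd (P.prod P') P' := measurePreserving_snd
  have mX : ∀ t ∈ J, MemLp (fun p : Ω × Ω' => X t p.1) 2 (P.prod P') := fun t ht =>
    (hX.memLp_two ht).comp_measurePreserving mfst
  have mV : ∀ t ∈ J, MemLp (fun p : Ω × Ω' => V t p.2) 2 (P.prod P') := fun t ht =>
    (hV.memLp_two ht).comp_measurePreserving msnd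
  have mW : ∀ t ∈ J, MemLp (fun p : Ω × Ω' => √(1 - ε) * X t p.1 + √ε * V t p.2) 2
      (P.prod P') := fun t ht => ((mX t ht).const_mul _).add ((mV t ht).const_mul _)
  have cent : ∀ t ∈ J, ∫ p, (√(1 - ε) * X t p.1 + √ε * V t p.2) ∂(P.prod P') = 0 := by
    intro t ht
    rw [integral_add (((mX t ht).integrable (by norm_num)).const_mul _)
      (((mV t ht).integrable (by norm_num)).const_mul _), integral_const_mul, integral_const_mul,
      integral_fun_fst (μ := P) (ν := P') (X t), integral_fun_snd (μ := P) (ν := P') (V t),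
      hX.centered t ht, hV.centered t ht]
    simp
  have prod : ∀ s ∈ J, ∀ t ∈ J, ∫ p, (√(1 - ε) * X s p.1 + √ε * V s p.2) *
      (√(1 - ε) * X t p.1 + √ε * V t p.2) ∂(P.prod P') = (1 - ε) * A s t + ε * D s t := by
    intro s hs t ht
    have e : ∀ p : Ω × Ω', (√(1 - ε) * X s p.1 + √ε * V s p.2) *
        (√(1 - ε) * X t p.1 + √ε * V t p.2) = ((1 - ε) * (X s p.1 * X t p.1) +
        ε * (V s p.2 * V t p.2)) + (√(1 - ε) * √ε * (X s p.1 * V t p.2) +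
        √(1 - ε) * √ε * (X t p.1 * V s p.2)) := by
      intro p
      have e1 := Real.mul_self_sqrt (sub_nonneg.2 h1)
      have e2 := Real.mul_self_sqrt h0
      linear_combination (X s p.1 * X t p.1) * e1 + (V s p.2 * V t p.2) * e2
    have i1 : Integrable (fun p : Ω × Ω' => (1 - ε) * (X s p.1 * X t p.1)) (P.prod P') :=
      ((mX s hs).integrable_mul (mX t ht)).const_mul _
    have i2 : Integrable (fun p : Ω × Ω' => ε * (V s p.2 * V t p.2)) (P.prod P') :=
      ((mV s hs).integrable_mul (mV t ht)).const_mul _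
    have i3 : Integrable (fun p : Ω × Ω' => √(1 - ε) * √ε * (X s p.1 * V t p.2)) (P.prod P') :=
      ((mX s hs).integrable_mul (mV t ht)).const_mul _
    have i4 : Integrable (fun p : Ω × Ω' => √(1 - ε) * √ε * (X t p.1 * V s p.2)) (P.prod P') :=
      ((mX t ht).integrable_mul (mV s hs)).const_mul _
    simp only [e]
    have i12 : Integrable (fun p : Ω × Ω' => (1 - ε) * (X s p.1 * X t p.1) +
        ε * (V s p.2 * V t p.2)) (P.prod P') := i1.add i2
    have i34 : Integrable (fun p : Ω × Ω' => √(1 - ε) * √ε * (X s p.1 * V t p.2) +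
        √(1 - ε) * √ε * (X t p.1 * V s p.2)) (P.prod P') := i3.add i4
    rw [integral_add i12 i34, integral_add i1 i2, integral_add i3 i4,
      integral_const_mul, integral_const_mul, integral_const_mul, integral_const_mul,
      integral_fun_fst (μ := P) (ν := P') fun ω => X s ω * X t ω,
      integral_fun_snd (μ := P) (ν := P') fun ω => V s ω * V t ω,
      integral_prod_mul (X s) (V t), integral_prod_mul (X t) (V s), hX.centered s hs,
      hX.centered t ht, hX.integral_mul hs ht, hV.integral_mul hs ht]
    simp
  refine ⟨⟨fun I => ?_⟩, cent, fun t ht => ?_, fun s hs t ht => ?_⟩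
  · have gX : HasGaussianLaw (fun p : Ω × Ω' => fun i : I => X i p.1) (P.prod P') :=
      (hX.gaussian.hasGaussianLaw I).comp_measurePreserving mfst
    have gV : HasGaussianLaw (fun p : Ω × Ω' => fun i : I => V i p.2) (P.prod P') :=
      (hV.gaussian.hasGaussianLaw I).comp_measurePreserving msnd
    have ind : IndepFun (fun p : Ω × Ω' => fun i : I => X i p.1)
        (fun p : Ω × Ω' => fun i : I => V i p.2) (P.prod P') :=
      indepFun_prod₀ (hX.gaussian.hasGaussianLaw I).aemeasurable
        (hV.gaussian.hasGaussianLaw I).aemeasurable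
    exact (ind.hasGaussianLaw gX gV).map
      (√(1 - ε) • ContinuousLinearMap.fst ℝ (I → ℝ) (I → ℝ) +
        √ε • ContinuousLinearMap.snd ℝ (I → ℝ) (I → ℝ))
  · have := prod t ht t ht
    rw [hX.diag ht, hV.diag ht] at this
    simp only [sq]
    rw [this]
    ring
  · rw [covariance_eq_sub (mW s hs) (mW t ht), cent s hs, zero_mul, sub_zero]
    exact prod s hs t ht

/-- A single standard Gaussian variable, as a process which is constant in time. -/
theorem isGaussianWithCorrelationOn_const (J : Set ℝ≥0) :
    IsGaussianWithCorrelationOn (gaussianReal 0 1) J (fun _ x => x) fun _ _ => 1 where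
  gaussian := ⟨fun I => by
    let L : ℝ →L[ℝ] (I → ℝ) := ContinuousLinearMap.pi fun _ => ContinuousLinearMap.id ℝ ℝ
    exact (IsGaussian.hasGaussianLaw_id (μ := gaussianReal 0 1)).map L⟩
  centered t _ := integral_id_gaussianReal
  normalized t _ := by
    have := variance_fun_id_gaussianReal (μ := 0) (v := 1)
    rw [variance_eq_integral (by fun_prop)] at this
    simpa using this
  correlation s _ t _ := by
    rw [covariance_self (by fun_prop)]
    simp

end Mixture

/-! ### Reduction to two bounds, and the sandwich condition. -/

section Family

variable {Ω : ℕ∞ → Type*} [∀ k, MeasurableSpace (Ω k)]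

theorem eventually_mem_timeDomain {T : ℕ∞ → ℝ≥0∞}
    (hT : Tendsto (fun k : ℕ => T k) atTop (𝓝 ⊤)) (M : ℝ≥0) :
    ∀ᶠ k : ℕ in atTop, M ∈ timeDomain (T k) := by
  filter_upwards [(tendsto_order.1 hT).1 M ENNReal.coe_lt_top] with k hk using hk.le

/-- Both bounds leave a gap between levels, as Slepian's inequality requires; the gap is closed here
by continuity of measure. The upper bound is needed on finite sets only, since it is the limit
process whose separability is used there. -/
theorem supProbConvergesAt_of_bounds {P : ∀ k, Measure (Ω k)} [∀ k, IsProbabilityMeasure (P k)]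
    {T : ℕ∞ → ℝ≥0∞} (hT_top : T ⊤ = ⊤) (hT : Tendsto (fun k : ℕ => T k) atTop (𝓝 ⊤))
    {Z : ∀ k, ℝ≥0 → Ω k → ℝ} {A : ℕ∞ → ℝ≥0 → ℝ≥0 → ℝ}
    (hZ : ∀ k, IsGaussianWithCorrelationOn (P k) (timeDomain (T k)) (Z k) (A k))
    (hsep : ∀ k, IsSeparableOn (P k) (timeDomain (T k)) (Z k)) {z : ℝ} {M : ℝ≥0}
    (hlow : ∀ c < z, P ⊤ {ω | pathSup (Z ⊤) 0 M ω ≤ c} ≤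
      liminf (fun k : ℕ => ⨅ (s : ℝ≥0) (_ : s + M ∈ timeDomain (T k)),
        P k {ω | pathSup (Z k) s M ω < z}) atTop)
    (hup : ∀ F : Finset ℝ≥0, (∀ t ∈ F, t ∈ Set.Iic M) → ∀ η > 0,
      limsup (fun k : ℕ => ⨆ (s : ℝ≥0) (_ : s + M ∈ timeDomain (T k)),
        P k {ω | ∀ t ∈ F, Z k (s + t) ω ≤ z}) atTop ≤
      P ⊤ {ω | ∀ t ∈ F, Z ⊤ t ω ≤ z + η}) :
    SupProbConvergesAt P T Z z M := by
  have huniv : ∀ t, t ∈ timeDomain (T ⊤) := fun t => by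
    rw [hT_top]; exact le_top (a := (t : ℝ≥0∞))
  refine ⟨measure_pathSup_lt_le_of_forall_le hlow, ?_, ?_⟩
  · refine (liminf_le_liminf ?_).trans (liminf_le_limsup)
    -- Over an empty set of shifts the infimum would be `⊤` and the supremum `0`. Since `T k → ∞`,
    -- the shift `0` is eventually admissible.
    filter_upwards [eventually_mem_timeDomain hT M] with k hk
    have h0 : (0 : ℝ≥0) + M ∈ timeDomain (T k) := by rwa [zero_add]
    exact (iInf₂_le 0 h0).trans (le_iSup₂ (f := fun (s : ℝ≥0) (_ : s + M ∈ timeDomain (T k)) =>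
        P k {ω | pathSup (Z k) s M ω < z}) 0 h0)
  · have hs : IsSeparableOn (P ⊤) (Set.Iic M) (Z ⊤) := by
      simpa using (hsep ⊤).shift 0 M fun t _ => huniv _
    refine le_measure_pathSup_le_of_forall_finset hs (fun t _ => (hZ ⊤).aemeasurable (huniv t))
      fun F hF η hη => le_trans (limsup_le_limsup (Eventually.of_forall fun k => ?_))
        (hup F hF η hη)
    refine iSup₂_mono fun s hs => measure_mono fun ω hω t ht => ?_
    rw [Set.mem_ofPred_eq, ← pathSup_shift] at hω
    obtain ⟨c, hc, h⟩ := pathSup_lt_iff.1 hω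
    exact (h t (hF t ht)).trans hc.le

end Family

/-- One-sided comparison when the correlation of `Y` dominates that of a mixture. -/
theorem measure_mul_measure_le_of_mixture_le {Ω Ω' Ω₁ : Type*} [MeasurableSpace Ω]
    [MeasurableSpace Ω'] [MeasurableSpace Ω₁] {P : Measure Ω} {P' : Measure Ω'} {Q : Measure Ω₁}
    {M : ℝ≥0} {X : ℝ≥0 → Ω → ℝ} {V : ℝ≥0 → Ω' → ℝ} {Y : ℝ≥0 → Ω₁ → ℝ}
    {A D B : ℝ≥0 → ℝ≥0 → ℝ} (hX : IsGaussianWithCorrelationOn P (Set.Iic M) X A)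
    (hV : IsGaussianWithCorrelationOn P' (Set.Iic M) V D)
    (hY : IsGaussianWithCorrelationOn Q (Set.Iic M) Y B)
    (hYs : IsSeparableOn Q (Set.Iic M) Y) {ε : ℝ} (h0 : 0 ≤ ε) (h1 : ε ≤ 1)
    (hB : ∀ t u, t ≤ u → u ≤ M → (1 - ε) * A t u + ε * D t u ≤ B t u)
    {c L a z : ℝ} (ha : √(1 - ε) * c + √ε * L ≤ a) (haz : a < z) :
    P {ω | pathSup X 0 M ω ≤ c} * P' {ω | ∀ t ≤ M, V t ω ≤ L}
      ≤ Q {ω | pathSup Y 0 M ω < z} := by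
  have := hX.isProbabilityMeasure
  have := hV.isProbabilityMeasure
  have := hY.isProbabilityMeasure
  -- Two gaps are spent: `a < b` in Slepian's inequality, and `b < z` in passing from finite sets to
  -- the supremum.
  obtain ⟨b, hab, hbz⟩ := exists_between haz
  refine le_measure_pathSup_lt_of_forall_finset hYs (fun t ht => hY.aemeasurable ht) hbz
    fun F hF => ?_
  have sl := measure_forall_le_le_measure_forall_lt_of_corr_le hY (hX.mixture hV h0 h1) hF
    (fun t _ u hu htu => hB t u htu (hF u hu)) hab
  refine le_trans ?_ sl
  rw [← Measure.prod_prod]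
  refine measure_mono ?_
  rintro ⟨ω, ω'⟩ ⟨h, h'⟩ t ht
  have e1 := pathSup_le_iff.1 h t (hF t ht)
  have e2 := h' t (hF t ht)
  refine le_trans ?_ ha
  dsimp only
  gcongr

/-- One-sided comparison when the correlation of `Y` is dominated by that of a mixture with a
constant process. -/
theorem measure_forall_le_le_of_le_mixture {Ω Ω₁ : Type*} [MeasurableSpace Ω]
    [MeasurableSpace Ω₁] {P : Measure Ω} {Q : Measure Ω₁} {M : ℝ≥0} {X : ℝ≥0 → Ω → ℝ}
    {Y : ℝ≥0 → Ω₁ → ℝ} {A B : ℝ≥0 → ℝ≥0 → ℝ}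
    (hX : IsGaussianWithCorrelationOn P (Set.Iic M) X A)
    (hY : IsGaussianWithCorrelationOn Q (Set.Iic M) Y B) {ε : ℝ} (h0 : 0 ≤ ε) (h1 : ε ≤ 1)
    (hB : ∀ t u, t ≤ u → u ≤ M → B t u ≤ (1 - ε) * A t u + ε)
    {F : Finset ℝ≥0} (hF : ∀ t ∈ F, t ∈ Set.Iic M) {z b c L : ℝ} (hzb : z < b)
    (hb : b ≤ √(1 - ε) * c - √ε * L) :
    Q {ω | ∀ t ∈ F, Y t ω ≤ z} ≤
      P {ω | ∀ t ∈ F, X t ω ≤ c} + gaussianReal 0 1 {x | L < |x|} := by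
  have := hX.isProbabilityMeasure
  have sl := measure_forall_le_le_measure_forall_lt_of_corr_le
    (hX.mixture (isGaussianWithCorrelationOn_const (Set.Iic M)) h0 h1) hY hF
    (fun t _ u hu htu => by simpa using hB t u htu (hF u hu)) hzb
  refine sl.trans ?_
  have e1 : P {ω | ∀ t ∈ F, X t ω ≤ c}
      = (P.prod (gaussianReal 0 1)) ({ω | ∀ t ∈ F, X t ω ≤ c} ×ˢ Set.univ) := by
    rw [Measure.prod_prod, measure_univ, mul_one]
  have e2 : gaussianReal 0 1 {x | L < |x|}
      = (P.prod (gaussianReal 0 1)) (Set.univ ×ˢ {x | L < |x|}) := by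
    rw [Measure.prod_prod, measure_univ, one_mul]
  rw [e1, e2]
  refine (measure_mono ?_).trans (measure_union_le _ _)
  rintro ⟨ω, x⟩ h
  by_cases hx : L < |x|
  · exact Or.inr ⟨trivial, hx⟩
  · refine Or.inl ⟨fun t ht => ?_, trivial⟩
    -- When `|x| ≤ L`, the mixture being below `b` bounds `√(1 - ε) X` by `√(1 - ε) c`. Strictness
    -- comes from the event, so `√(1 - ε) = 0` is harmless.
    by_contra hc
    have hc' : c < X t ω := not_le.1 hc
    have h3 : √(1 - ε) * X t ω + √ε * x < b := h t ht
    have h4 : -L ≤ x := (neg_le_neg (not_lt.1 hx)).trans (neg_abs_le x)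
    have h5 : √(1 - ε) * c ≤ √(1 - ε) * X t ω := by gcongr
    have h6 : √ε * (-L) ≤ √ε * x := by gcongr
    linarith

theorem tendsto_sqrt_mixture {ε : ℕ → ℝ} (hε : Tendsto ε atTop (𝓝 0)) (c L : ℝ) :
    Tendsto (fun k => √(1 - ε k) * c + √(ε k) * L) atTop (𝓝 c) := by
  have : Tendsto (fun k => √(1 - ε k) * c + √(ε k) * L) atTop (𝓝 (√(1 - 0) * c + √0 * L)) := by
    refine Tendsto.add (Tendsto.mul_const _ ?_) (Tendsto.mul_const _ ?_)
    · exact (Real.continuous_sqrt.tendsto _).comp (hε.const_sub 1)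
    · exact (Real.continuous_sqrt.tendsto _).comp hε
  simpa using this

theorem iSup_measure_forall_le_eq_one {Ω : Type*} [MeasurableSpace Ω] {P : Measure Ω}
    [IsProbabilityMeasure P] {V : ℝ≥0 → Ω → ℝ} (hV : ∀ᵐ ω ∂P, Continuous fun t => V t ω)
    (M : ℝ≥0) : ⨆ L : ℕ, P {ω | ∀ t ≤ M, V t ω ≤ L} = 1 := by
  have hmono : Monotone fun L : ℕ => {ω | ∀ t ≤ M, V t ω ≤ (L : ℝ)} := fun a b hab ω hω t ht =>
    (hω t ht).trans (by exact_mod_cast hab)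
  rw [← hmono.measure_iUnion, ← measure_univ (μ := P)]
  refine measure_congr (eventuallyEq_univ.2 ?_)
  filter_upwards [hV] with ω hω
  obtain ⟨C, hC⟩ := (isCompact_Icc (a := (0 : ℝ≥0)) (b := M)).bddAbove_image hω.continuousOn
  obtain ⟨L, hL⟩ := exists_nat_ge C
  refine Set.mem_iUnion.2 ⟨L, fun t ht => le_trans (hC ⟨t, ⟨bot_le, ht⟩, rfl⟩) hL⟩

/-- The sandwich condition implies convergence at every level and for every horizon. -/
theorem supProbConvergesAt_of_sandwich {Ω : ℕ∞ → Type*} [∀ k, MeasurableSpace (Ω k)]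
    {P : ∀ k, Measure (Ω k)} [∀ k, IsProbabilityMeasure (P k)]
    {T : ℕ∞ → ℝ≥0∞} (hT_top : T ⊤ = ⊤) (hT : Tendsto (fun k : ℕ => T k) atTop (𝓝 ⊤))
    {Z : ∀ k, ℝ≥0 → Ω k → ℝ} {A : ℕ∞ → ℝ≥0 → ℝ≥0 → ℝ}
    (hZ : ∀ k, IsGaussianWithCorrelationOn (P k) (timeDomain (T k)) (Z k) (A k))
    (hsep : ∀ k, IsSeparableOn (P k) (timeDomain (T k)) (Z k))
    (hA : IsStationaryCorrelationOn Set.univ (A ⊤))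
    {Ω' : Type*} [MeasurableSpace Ω'] {P' : Measure Ω'} {V : ℝ≥0 → Ω' → ℝ}
    {D : ℝ≥0 → ℝ≥0 → ℝ} (hD : IsStationaryCorrelationOn Set.univ D)
    (hV : IsGaussianWithCorrelationOn P' Set.univ V D)
    (hVc : ∀ᵐ ω ∂P', Continuous fun t => V t ω) {M : ℝ≥0} {ε : ℕ → ℝ} (hε0 : ∀ k, 0 < ε k)
    (hε : Tendsto ε atTop (𝓝 0))
    (hsand : ∀ (k : ℕ) (s τ : ℝ≥0), τ ≤ M → s + τ ∈ timeDomain (T k) →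
      (1 - ε k) * A ⊤ 0 τ + ε k * D 0 τ ≤ A k s (s + τ) ∧
      A k s (s + τ) ≤ (1 - ε k) * A ⊤ 0 τ + ε k) (z : ℝ) :
    SupProbConvergesAt P T Z z M := by
  have := hV.isProbabilityMeasure
  have huniv : ∀ t, t ∈ timeDomain (T ⊤) := fun t => by
    rw [hT_top]; exact le_top (a := (t : ℝ≥0∞))
  have hX : IsGaussianWithCorrelationOn (P ⊤) (Set.Iic M) (Z ⊤) (A ⊤) :=
    (hZ ⊤).mono fun t _ => huniv t
  have hV' := hV.mono (Set.subset_univ (Set.Iic M))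
  have hdom : ∀ (k : ℕ) (s : ℝ≥0), s + M ∈ timeDomain (T k) → ∀ t ≤ M,
      s + t ∈ timeDomain (T k) := fun k s hs t ht => mem_timeDomain_of_le (by gcongr) hs
  -- Stationarity of `A ⊤` and `D` turns the condition on lags into a comparison with one fixed
  -- mixture, the same for all windows.
  have hB : ∀ (k : ℕ) (s : ℝ≥0), s + M ∈ timeDomain (T k) → ∀ t u, t ≤ u → u ≤ M →
      (1 - ε k) * A ⊤ t u + ε k * D t u ≤ A k (s + t) (s + u) ∧
      A k (s + t) (s + u) ≤ (1 - ε k) * A ⊤ t u + ε k := by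
    intro k s hs t u htu hu
    have h := hsand k (s + t) (u - t) (tsub_le_self.trans hu) (by
      rw [add_assoc, add_tsub_cancel_of_le htu]; exact hdom k s hs u hu)
    have e1 := hA.stationary t (u - t) trivial
    have e2 := hD.stationary t (u - t) trivial
    rw [add_tsub_cancel_of_le htu] at e1 e2
    rwa [add_assoc, add_tsub_cancel_of_le htu, ← e1, ← e2] at h
  have hε1 : ∀ᶠ k in atTop, ε k ≤ 1 := by
    filter_upwards [(tendsto_order.1 hε).2 1 one_pos] with k hk using hk.le
  refine supProbConvergesAt_of_bounds hT_top hT hZ hsep (fun c hc => ?_) fun F hF η hη => ?_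
  · obtain ⟨a, hca, haz⟩ := exists_between hc
    have main : ∀ L : ℕ, P ⊤ {ω | pathSup (Z ⊤) 0 M ω ≤ c} * P' {ω | ∀ t ≤ M, V t ω ≤ L} ≤
        liminf (fun k : ℕ => ⨅ (s : ℝ≥0) (_ : s + M ∈ timeDomain (T k)),
          P k {ω | pathSup (Z k) s M ω < z}) atTop := by
      intro L
      refine le_liminf_of_le (by isBoundedDefault) ?_
      filter_upwards [hε1, (tendsto_order.1 (tendsto_sqrt_mixture hε c L)).2 a hca] with k hk1 hka
      refine le_iInf₂ fun s hs => ?_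
      have := measure_mul_measure_le_of_mixture_le hX hV' ((hZ k).shift s (hdom k s hs))
        ((hsep k).shift s M (hdom k s hs)) (hε0 k).le hk1
        (fun t u htu hu => (hB k s hs t u htu hu).1) hka.le haz
      simpa only [pathSup_shift] using this
    -- Letting `L → ∞` removes the factor due to `V`.
    have h2 := iSup_le main
    rwa [← ENNReal.mul_iSup, iSup_measure_forall_le_eq_one hVc, mul_one] at h2
  · refine le_of_forall_pos_le_add fun δ hδ => ?_
    obtain ⟨L, hL⟩ := exists_nat_measure_lt_abs_lt (P := gaussianReal 0 1) (f := id)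
      aemeasurable_id hδ
    refine limsup_le_of_le (by isBoundedDefault) ?_
    have lim := tendsto_sqrt_mixture hε (z + η) (-L)
    filter_upwards [hε1, (tendsto_order.1 lim).1 (z + η / 2) (by linarith)] with k hk1 hkb
    refine iSup₂_le fun s hs => ?_
    refine (measure_forall_le_le_of_le_mixture hX ((hZ k).shift s (hdom k s hs)) (hε0 k).le hk1
      (fun t u htu hu => (hB k s hs t u htu hu).2) hF (b := z + η / 2) (c := z + η) (L := L)
      (by linarith) (by linarith)).trans ?_
    gcongr
    exact hL.le

/-! ### Gaussian tails of increments. -/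

/-- This is Chernoff's bound on both sides. Strict inequality in the event keeps it valid for `p =
0`, where the law is a point mass at `0`. -/
theorem gaussianReal_lt_abs_le {v : ℝ≥0} {p x : ℝ} (hp : 0 ≤ p) (hx : 0 ≤ x)
    (hv : (v : ℝ) ≤ p ^ 2) :
    gaussianReal 0 v {y | x * p < |y|} ≤ ENNReal.ofReal (2 * Real.exp (-x ^ 2 / 2)) := by
  rcases hp.eq_or_lt with rfl | hp
  · have : v = 0 := by
      apply le_antisymm _ bot_le
      rw [← NNReal.coe_le_coe]; simpa using hv
    rw [this, gaussianReal_zero_var, Measure.dirac_apply' _ (measurableSet_lt (by fun_prop)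
      (by fun_prop))]
    simp
  · have hsub : HasSubgaussianMGF id (p ^ 2).toNNReal (gaussianReal 0 v) := by
      refine ⟨fun t => integrable_exp_mul_gaussianReal t, fun t => ?_⟩
      rw [mgf_id_gaussianReal]
      beta_reduce
      rw [Real.coe_toNNReal _ (sq_nonneg p), zero_mul, zero_add]
      gcongr
    have e : ((p ^ 2).toNNReal : ℝ) = p ^ 2 := Real.coe_toNNReal _ (sq_nonneg p)
    have h1 := hsub.measure_ge_le (ε := x * p) (by positivity)
    have h2 := hsub.neg.measure_ge_le (ε := x * p) (by positivity)
    have e2 : -(x * p) ^ 2 / (2 * ((p ^ 2).toNNReal : ℝ)) = -x ^ 2 / 2 := by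
      rw [e]; field_simp
    rw [e2] at h1 h2
    rw [two_mul, ← ENNReal.ofReal_toReal (measure_ne_top (gaussianReal 0 v) _)]
    refine ENNReal.ofReal_le_ofReal ?_
    refine le_trans ?_ (add_le_add h1 h2)
    refine le_trans (measureReal_mono ?_) (measureReal_union_le _ _)
    intro y hy
    rcases lt_abs.1 (show x * p < |y| from hy) with h | h
    · exact Or.inl h.le
    · exact Or.inr h.le

theorem IsGaussianWithCorrelationOn.measure_lt_abs_sub_le {Ω : Type*} [MeasurableSpace Ω]
    {P : Measure Ω} {J : Set ℝ≥0} {X : ℝ≥0 → Ω → ℝ} {A : ℝ≥0 → ℝ≥0 → ℝ}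
    (h : IsGaussianWithCorrelationOn P J X A) {s t : ℝ≥0} (hs : s ∈ J) (ht : t ∈ J) {p x : ℝ}
    (hp : 0 ≤ p) (hx : 0 ≤ x) (hA : 2 - 2 * A s t ≤ p ^ 2) :
    P {ω | x * p < |X s ω - X t ω|} ≤ ENNReal.ofReal (2 * Real.exp (-x ^ 2 / 2)) := by
  have := h.isProbabilityMeasure
  have hG : HasGaussianLaw (fun ω => X s ω - X t ω) P :=
    h.gaussian.hasGaussianLaw_fun_sub (s := ⟨s, hs⟩) (t := ⟨t, ht⟩)
  have hm : ∫ ω, (X s ω - X t ω) ∂P = 0 := by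
    rw [integral_sub ((h.memLp_two hs).integrable (by norm_num))
      ((h.memLp_two ht).integrable (by norm_num)), h.centered s hs, h.centered t ht, sub_zero]
  have hv : Var[fun ω => X s ω - X t ω; P] = 2 - 2 * A s t := by
    rw [variance_of_integral_eq_zero hG.aemeasurable hm]
    exact h.integral_sub_sq hs ht
  have hmap := hG.map_eq_gaussianReal
  rw [hm, hv] at hmap
  have e : P {ω | x * p < |X s ω - X t ω|}
      = (P.map fun ω => X s ω - X t ω) {y | x * p < |y|} := by
    rw [Measure.map_apply_of_aemeasurable hG.aemeasurable
      (measurableSet_lt (by fun_prop) (by fun_prop))]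
    rfl
  rw [e, hmap]
  exact gaussianReal_lt_abs_le hp hx (by
    rw [Real.coe_toNNReal']; exact max_le hA (sq_nonneg p))

/-! ### Doubly exponential grids -/

/-- The number of grid points per unit of time at level `n`. -/
def gridSize (n : ℕ) : ℕ := 2 ^ 4 ^ n

theorem gridSize_pos (n : ℕ) : 0 < gridSize n := by unfold gridSize; positivity

theorem gridSize_dvd_succ (n : ℕ) : ∃ K, gridSize (n + 1) = gridSize n * K :=
  pow_dvd_pow 2 (Nat.pow_le_pow_right (by norm_num) n.le_succ)

/-- The largest grid point of level `n` below `t`. -/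
noncomputable def gridFloor (n : ℕ) (t : ℝ≥0) : ℝ≥0 := ⌊t * gridSize n⌋₊ / gridSize n

/-- The grid points of level `n` in `[0, M]`. -/
noncomputable def gridPoints (M : ℝ≥0) (n : ℕ) : Finset ℝ≥0 :=
  open Classical in
  (Finset.range (⌊M * gridSize n⌋₊ + 1)).image fun j : ℕ => (j : ℝ≥0) / gridSize n

theorem mem_gridPoints {M : ℝ≥0} {n : ℕ} {t : ℝ≥0} : t ∈ gridPoints M n ↔
    ∃ j : ℕ, j ≤ ⌊M * gridSize n⌋₊ ∧ (j : ℝ≥0) / gridSize n = t := by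
  simp [gridPoints]

theorem le_of_mem_gridPoints {M : ℝ≥0} {n : ℕ} {t : ℝ≥0} (ht : t ∈ gridPoints M n) : t ≤ M := by
  obtain ⟨j, hj, rfl⟩ := mem_gridPoints.1 ht
  have hN : (0 : ℝ≥0) < gridSize n := by exact_mod_cast gridSize_pos n
  rw [div_le_iff₀ hN]
  exact (Nat.le_floor_iff bot_le).1 hj

theorem card_gridPoints_le (M : ℝ≥0) (n : ℕ) :
    ((gridPoints M n).card : ℝ) ≤ (M + 1) * gridSize n := by
  have h1 : (gridPoints M n).card ≤ ⌊M * gridSize n⌋₊ + 1 := by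
    refine Finset.card_image_le.trans ?_
    simp
  have h2 : ((⌊M * gridSize n⌋₊ : ℕ) : ℝ≥0) ≤ M * gridSize n := Nat.floor_le bot_le
  have h3 : ((⌊M * gridSize n⌋₊ : ℕ) : ℝ) ≤ M * gridSize n := by exact_mod_cast h2
  have h4 : (1 : ℝ) ≤ gridSize n := by exact_mod_cast gridSize_pos n
  calc ((gridPoints M n).card : ℝ) ≤ ⌊M * gridSize n⌋₊ + 1 := by exact_mod_cast h1
    _ ≤ _ := by linarith

theorem gridFloor_mem {M t : ℝ≥0} (ht : t ≤ M) (n : ℕ) : gridFloor n t ∈ gridPoints M n :=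
  mem_gridPoints.2 ⟨_, Nat.floor_le_floor (by gcongr), rfl⟩

theorem gridPoints_subset_succ (M : ℝ≥0) (n : ℕ) : gridPoints M n ⊆ gridPoints M (n + 1) := by
  intro t ht
  obtain ⟨j, hj, rfl⟩ := mem_gridPoints.1 ht
  obtain ⟨K, hK⟩ := gridSize_dvd_succ n
  have hK0 : 0 < K := Nat.pos_of_ne_zero fun h => by
    have := gridSize_pos (n + 1); rw [hK, h] at this; simp at this
  have hN : (0 : ℝ≥0) < gridSize n := by exact_mod_cast gridSize_pos n
  have hK1 : (0 : ℝ≥0) < K := by exact_mod_cast hK0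
  refine mem_gridPoints.2 ⟨j * K, ?_, ?_⟩
  · rw [Nat.le_floor_iff bot_le] at hj ⊢
    rw [hK]
    push_cast
    rw [← mul_assoc]
    gcongr
  · rw [hK]
    push_cast
    field_simp

theorem gridFloor_le (n : ℕ) (t : ℝ≥0) : gridFloor n t ≤ t := by
  have hN : (0 : ℝ≥0) < gridSize n := by exact_mod_cast gridSize_pos n
  rw [gridFloor, div_le_iff₀ hN]
  exact Nat.floor_le bot_le

theorem lt_gridFloor_add (n : ℕ) (t : ℝ≥0) : (t : ℝ) < gridFloor n t + 1 / gridSize n := by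
  have hN : (0 : ℝ) < gridSize n := by exact_mod_cast gridSize_pos n
  have h : t * gridSize n < ⌊t * gridSize n⌋₊ + 1 := Nat.lt_floor_add_one _
  have h' : (t : ℝ) * gridSize n < ⌊t * gridSize n⌋₊ + 1 := by exact_mod_cast h
  rw [gridFloor]
  push_cast
  rw [← add_div, lt_div_iff₀ hN]
  exact h'

theorem gridFloor_le_succ (n : ℕ) (t : ℝ≥0) : gridFloor n t ≤ gridFloor (n + 1) t := by
  have hN : (0 : ℝ≥0) < gridSize n := by exact_mod_cast gridSize_pos n
  have hN' : (0 : ℝ≥0) < gridSize (n + 1) := by exact_mod_cast gridSize_pos (n + 1)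
  -- Taking `t` itself as the horizon exhibits the coarse floor as a fine grid point not exceeding
  -- `t`.
  obtain ⟨j, hj, he⟩ := mem_gridPoints.1 (gridPoints_subset_succ t n (gridFloor_mem le_rfl n))
  rw [← he, gridFloor]
  gcongr

theorem abs_gridFloor_succ_sub_le (n : ℕ) (t : ℝ≥0) :
    dist (gridFloor n t) (gridFloor (n + 1) t) ≤ 1 / gridSize n := by
  have h1 : (gridFloor n t : ℝ) ≤ gridFloor (n + 1) t := gridFloor_le_succ n t
  have h2 : (gridFloor (n + 1) t : ℝ) ≤ t := gridFloor_le (n + 1) t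
  have h3 := lt_gridFloor_add n t
  rw [NNReal.dist_eq, abs_le]
  constructor <;> linarith [show (0 : ℝ) ≤ 1 / gridSize n by positivity]

theorem dist_gridFloor_self_lt (n : ℕ) (t : ℝ≥0) :
    dist (gridFloor n t) t < 1 / gridSize n := by
  have hN : (0 : ℝ) < gridSize n := by exact_mod_cast gridSize_pos n
  have h2 : (gridFloor n t : ℝ) ≤ t := gridFloor_le n t
  have h3 := lt_gridFloor_add n t
  rw [NNReal.dist_eq, abs_lt]
  constructor <;> linarith [show (0 : ℝ) < 1 / gridSize n by positivity]

/-- Two times closer than one mesh have equal or adjacent floors. -/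
theorem dist_gridFloor_le {n : ℕ} {s t : ℝ≥0} (h : dist s t < 1 / gridSize n) :
    dist (gridFloor n s) (gridFloor n t) ≤ 1 / gridSize n := by
  wlog hst : s ≤ t generalizing s t
  · rw [dist_comm]
    exact this (by rwa [dist_comm]) (le_of_not_ge hst)
  have hN : (0 : ℝ) < gridSize n := by exact_mod_cast gridSize_pos n
  have hm : (⌊s * gridSize n⌋₊ : ℕ) ≤ ⌊t * gridSize n⌋₊ := Nat.floor_le_floor (by gcongr)
  rw [NNReal.dist_eq, abs_sub_comm, abs_of_nonneg (sub_nonneg.2 (by exact_mod_cast hst)),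
    lt_div_iff₀ hN, sub_mul] at h
  have h1 : ((⌊t * gridSize n⌋₊ : ℕ) : ℝ≥0) ≤ t * gridSize n := Nat.floor_le bot_le
  have h1' : ((⌊t * gridSize n⌋₊ : ℕ) : ℝ) ≤ t * gridSize n := by exact_mod_cast h1
  have h2 : s * gridSize n < ⌊s * gridSize n⌋₊ + 1 := Nat.lt_floor_add_one _
  have h2' : (s : ℝ) * gridSize n < ⌊s * gridSize n⌋₊ + 1 := by exact_mod_cast h2
  have h3 : ((⌊t * gridSize n⌋₊ : ℕ) : ℝ) < (⌊s * gridSize n⌋₊ + 2 : ℕ) := by push_cast; linarith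
  have h4 : ⌊t * gridSize n⌋₊ < ⌊s * gridSize n⌋₊ + 2 := by exact_mod_cast h3
  have h5 : ((⌊t * gridSize n⌋₊ : ℕ) : ℝ) ≤ (⌊s * gridSize n⌋₊ + 1 : ℕ) := by
    exact_mod_cast Nat.lt_succ_iff.1 h4
  have h6 : ((⌊s * gridSize n⌋₊ : ℕ) : ℝ) ≤ ⌊t * gridSize n⌋₊ := by exact_mod_cast hm
  rw [NNReal.dist_eq, gridFloor, gridFloor]
  push_cast at h5 ⊢
  rw [← sub_div, abs_div, abs_of_pos hN]
  gcongr
  rw [abs_le]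
  constructor <;> linarith

/-! ### Chaining along the grids. -/

section Chaining

variable {Ω : Type*} [MeasurableSpace Ω] {P : Measure Ω} {X : ℝ≥0 → Ω → ℝ}
  {A : ℝ≥0 → ℝ≥0 → ℝ} {M : ℝ≥0} {p : ℕ → ℝ}

/-- The event that some increment over neighbouring grid points of level `n + 1` is large. -/
def largeIncrement (X : ℝ≥0 → Ω → ℝ) (M : ℝ≥0) (p : ℕ → ℝ) (n : ℕ) : Set Ω :=
  {ω | ∃ a ∈ gridPoints M (n + 1), ∃ b ∈ gridPoints M (n + 1),
    dist a b ≤ 1 / gridSize n ∧ 5 * 2 ^ n * p n < |X a ω - X b ω|}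

/-- Some increment is large at a level at least `m`. -/
def largeIncrementFrom (X : ℝ≥0 → Ω → ℝ) (M : ℝ≥0) (p : ℕ → ℝ) (m : ℕ) : Set Ω :=
  ⋃ n : ℕ, largeIncrement X M p (m + n)

/-- The modulus of continuity at scale `1 / gridSize m`, off the event `largeIncrementFrom`. -/
noncomputable def chainBound (p : ℕ → ℝ) (m : ℕ) : ℝ := ∑' n, 5 * 2 ^ (m + n) * p (m + n)

/-- This is where the factor `5` comes from. The number of pairs is of order `exp (8 · 4^n)` while
the Gaussian tail at `5 · 2^n` contributes `exp (-12.5 · 4^n)`, so the tail wins with room to spare.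
-/
theorem exp_chaining_le (M : ℝ≥0) (n : ℕ) :
    ((M + 1 : ℝ) * gridSize (n + 1)) ^ 2 * (2 * Real.exp (-(5 * 2 ^ n : ℝ) ^ 2 / 2))
      ≤ 2 * (M + 1) ^ 2 * (1 / 2) ^ n := by
  have h1 : (gridSize (n + 1) : ℝ) ≤ Real.exp (4 * 4 ^ n) := by
    rw [gridSize]
    push_cast
    calc (2 : ℝ) ^ 4 ^ (n + 1) ≤ (Real.exp 1) ^ 4 ^ (n + 1) := by
          gcongr
          have := Real.add_one_le_exp 1
          linarith
      _ = Real.exp (4 * 4 ^ n) := by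
          rw [← Real.exp_nat_mul]
          push_cast
          ring_nf
  have h2 : (gridSize (n + 1) : ℝ) ^ 2 * Real.exp (-(5 * 2 ^ n : ℝ) ^ 2 / 2) ≤ (1 / 2) ^ n := by
    calc (gridSize (n + 1) : ℝ) ^ 2 * Real.exp (-(5 * 2 ^ n : ℝ) ^ 2 / 2)
        ≤ (Real.exp (4 * 4 ^ n)) ^ 2 * Real.exp (-(5 * 2 ^ n : ℝ) ^ 2 / 2) := by gcongr
      _ = Real.exp (-(9 / 2 * 4 ^ n)) := by
          rw [← Real.exp_nat_mul, ← Real.exp_add]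
          congr 1
          rw [show (4 : ℝ) ^ n = (2 ^ n) ^ 2 by rw [← pow_mul, mul_comm, pow_mul]; norm_num]
          push_cast; ring
      _ ≤ Real.exp (-(n : ℝ)) := by
          gcongr
          have : n < 4 ^ n := Nat.lt_pow_self (by norm_num)
          have h4 : (n : ℝ) ≤ 4 ^ n := by exact_mod_cast this.le
          linarith
      _ = (Real.exp (-1)) ^ n := by
          rw [← Real.exp_nat_mul]; ring_nf
      _ ≤ (1 / 2) ^ n := by
          gcongr
          rw [Real.exp_neg, inv_eq_one_div]
          gcongr
          have := Real.add_one_le_exp 1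
          linarith
  calc ((M + 1 : ℝ) * gridSize (n + 1)) ^ 2 * (2 * Real.exp (-(5 * 2 ^ n : ℝ) ^ 2 / 2))
      = 2 * (M + 1 : ℝ) ^ 2 *
        ((gridSize (n + 1) : ℝ) ^ 2 * Real.exp (-(5 * 2 ^ n : ℝ) ^ 2 / 2)) := by ring
    _ ≤ _ := by gcongr

theorem measure_largeIncrement_le (h : IsGaussianWithCorrelationOn P (Set.Iic M) X A)
    (hp : ∀ n, 0 ≤ p n)
    (hA : ∀ n, ∀ s ≤ M, ∀ t ≤ M, dist s t ≤ 1 / gridSize n → 2 - 2 * A s t ≤ p n ^ 2) (n : ℕ) :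
    P (largeIncrement X M p n) ≤ ENNReal.ofReal (2 * (M + 1) ^ 2 * (1 / 2) ^ n) := by
  classical
  set G := gridPoints M (n + 1) with hG
  set r := ENNReal.ofReal (2 * Real.exp (-(5 * 2 ^ n : ℝ) ^ 2 / 2)) with hr
  have hsub : largeIncrement X M p n ⊆ ⋃ a ∈ G, ⋃ b ∈ G,
      {ω | dist a b ≤ 1 / gridSize n ∧ 5 * 2 ^ n * p n < |X a ω - X b ω|} := by
    rintro ω ⟨a, ha, b, hb, h⟩
    exact Set.mem_iUnion₂.2 ⟨a, ha, Set.mem_iUnion₂.2 ⟨b, hb, h⟩⟩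
  have hone : ∀ a ∈ G, ∀ b ∈ G,
      P {ω | dist a b ≤ 1 / gridSize n ∧ 5 * 2 ^ n * p n < |X a ω - X b ω|} ≤ r := by
    intro a ha b hb
    have ha' := le_of_mem_gridPoints ha
    have hb' := le_of_mem_gridPoints hb
    by_cases hab : dist a b ≤ 1 / gridSize n
    · refine (measure_mono fun ω hω => hω.2).trans
        (h.measure_lt_abs_sub_le ha' hb' (hp n) (by positivity) (hA n a ha' b hb' hab))
    · simp only [hab, false_and]
      simp
  calc P (largeIncrement X M p n)
      ≤ ∑ a ∈ G, ∑ b ∈ G, r := by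
        refine (measure_mono hsub).trans ((measure_biUnion_finset_le _ _).trans ?_)
        refine Finset.sum_le_sum fun a ha => (measure_biUnion_finset_le _ _).trans ?_
        exact Finset.sum_le_sum fun b hb => hone a ha b hb
    _ = ENNReal.ofReal ((G.card : ℝ) ^ 2 * (2 * Real.exp (-(5 * 2 ^ n : ℝ) ^ 2 / 2))) := by
        rw [ENNReal.ofReal_mul (by positivity), ENNReal.ofReal_pow (by positivity),
          ENNReal.ofReal_natCast]
        simp only [Finset.sum_const, nsmul_eq_mul, hr]
        ring
    _ ≤ _ := by
        refine ENNReal.ofReal_le_ofReal (le_trans ?_ (exp_chaining_le M n))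
        gcongr
        exact card_gridPoints_le M (n + 1)

theorem measure_largeIncrementFrom_le (h : IsGaussianWithCorrelationOn P (Set.Iic M) X A)
    (hp : ∀ n, 0 ≤ p n)
    (hA : ∀ n, ∀ s ≤ M, ∀ t ≤ M, dist s t ≤ 1 / gridSize n → 2 - 2 * A s t ≤ p n ^ 2) (m : ℕ) :
    P (largeIncrementFrom X M p m) ≤ ENNReal.ofReal (4 * (M + 1) ^ 2 * (1 / 2) ^ m) := by
  have hs : HasSum (fun n : ℕ => 2 * (M + 1 : ℝ) ^ 2 * (1 / 2) ^ (m + n))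
      (4 * (M + 1 : ℝ) ^ 2 * (1 / 2) ^ m) := by
    have := (hasSum_geometric_two).mul_left (2 * (M + 1 : ℝ) ^ 2 * (1 / 2) ^ m)
    convert! this using 1
    · ext n; rw [pow_add]; ring
    · ring
  calc P (largeIncrementFrom X M p m)
      ≤ ∑' n, P (largeIncrement X M p (m + n)) := measure_iUnion_le _
    _ ≤ ∑' n, ENNReal.ofReal (2 * (M + 1) ^ 2 * (1 / 2) ^ (m + n)) :=
        ENNReal.tsum_le_tsum fun n => measure_largeIncrement_le h hp hA _
    _ = _ := by
        rw [← ENNReal.ofReal_tsum_of_nonneg (fun n => by positivity) hs.summable, hs.tsum_eq]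

omit [MeasurableSpace Ω] in
theorem antitone_largeIncrementFrom : Antitone (largeIncrementFrom X M p) := by
  intro a b hab
  refine Set.iUnion_subset fun n => ?_
  have : b + n = a + (b - a + n) := by omega
  rw [this]
  exact Set.subset_iUnion (fun n => largeIncrement X M p (a + n)) (b - a + n)

/-- The large-increment events see grid points only. Borel-Cantelli links a fixed time off the grid
to its floors, and is later applied along a countable separating set. -/
theorem ae_tendsto_gridFloor (h : IsGaussianWithCorrelationOn P (Set.Iic M) X A)
    (hp : ∀ n, 0 ≤ p n)
    (hA : ∀ n, ∀ s ≤ M, ∀ t ≤ M, dist s t ≤ 1 / gridSize n → 2 - 2 * A s t ≤ p n ^ 2)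
    (hsum : Summable fun n => 5 * 2 ^ n * p n) {t : ℝ≥0} (ht : t ≤ M) :
    ∀ᵐ ω ∂P, Tendsto (fun n => X (gridFloor n t) ω) atTop (𝓝 (X t ω)) := by
  have hb : ∀ n, P {ω | 5 * 2 ^ n * p n < |X (gridFloor n t) ω - X t ω|} ≤
      ENNReal.ofReal (2 * (M + 1) ^ 2 * (1 / 2) ^ n) := fun n => by
    have hf : gridFloor n t ≤ M := (gridFloor_le n t).trans ht
    refine (h.measure_lt_abs_sub_le hf ht (hp n) (by positivity)
      (hA n _ hf _ ht (dist_gridFloor_self_lt n t).le)).trans (ENNReal.ofReal_le_ofReal ?_)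
    -- The counting factor is at least `1`, so the estimate for all pairs also covers a single
    -- increment.
    refine le_trans (le_mul_of_one_le_left (by positivity) ?_) (exp_chaining_le M n)
    have h1 : (1 : ℝ) ≤ gridSize (n + 1) := by exact_mod_cast gridSize_pos (n + 1)
    have h2 : (1 : ℝ) ≤ M + 1 := by linarith [M.coe_nonneg]
    exact one_le_pow₀ (one_le_mul_of_one_le_of_one_le h2 h1)
  have hfin : ∑' n, P {ω | 5 * 2 ^ n * p n < |X (gridFloor n t) ω - X t ω|} ≠ ∞ := by
    refine ne_top_of_le_ne_top ?_ (ENNReal.tsum_le_tsum hb)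
    rw [← ENNReal.ofReal_tsum_of_nonneg (fun n => by positivity)
      (summable_geometric_two.mul_left _)]
    exact ENNReal.ofReal_ne_top
  filter_upwards [ae_eventually_notMem hfin] with ω hω
  rw [tendsto_iff_dist_tendsto_zero]
  refine squeeze_zero' (Eventually.of_forall fun n => dist_nonneg) ?_
    hsum.tendsto_atTop_zero
  filter_upwards [hω] with n hn
  exact not_lt.1 hn

-- The path goes from `s` to its floor of level `m`, across to the floor of `t`, and up to `t`. Each
-- outer leg telescopes through finer floors, and the middle one is a single increment of level `m`;
-- this explains the factor `3`.
omit [MeasurableSpace Ω] in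
theorem dist_le_of_notMem_largeIncrementFrom (hp : ∀ n, 0 ≤ p n)
    (hsum : Summable fun n => 5 * 2 ^ n * p n) {m : ℕ} {ω : Ω}
    (hω : ω ∉ largeIncrementFrom X M p m) {s t : ℝ≥0} (hs : s ≤ M) (ht : t ≤ M)
    (hst : dist s t < 1 / gridSize m)
    (ls : Tendsto (fun n => X (gridFloor n s) ω) atTop (𝓝 (X s ω)))
    (lt : Tendsto (fun n => X (gridFloor n t) ω) atTop (𝓝 (X t ω))) :
    |X s ω - X t ω| ≤ 3 * chainBound p m := by
  have hinc : ∀ n, ∀ a ∈ gridPoints M (m + n + 1), ∀ b ∈ gridPoints M (m + n + 1),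
      dist a b ≤ 1 / gridSize (m + n) → |X a ω - X b ω| ≤ 5 * 2 ^ (m + n) * p (m + n) := by
    intro n a ha b hb hab
    by_contra hc
    exact hω (Set.mem_iUnion.2 ⟨n, a, ha, b, hb, hab, not_le.1 hc⟩)
  have hsum' : Summable fun n => 5 * 2 ^ (m + n) * p (m + n) := by
    have := (summable_nat_add_iff m).2 hsum
    simpa only [add_comm _ m] using this
  have tail : ∀ u ≤ M, Tendsto (fun n => X (gridFloor n u) ω) atTop (𝓝 (X u ω)) →
      |X (gridFloor m u) ω - X u ω| ≤ chainBound p m := by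
    intro u hu lu
    have l : Tendsto (fun n => X (gridFloor (m + n) u) ω) atTop (𝓝 (X u ω)) := by
      have := (tendsto_add_atTop_iff_nat m).2 lu
      simpa only [add_comm _ m] using this
    have := dist_le_tsum_of_dist_le_of_tendsto (f := fun n => X (gridFloor (m + n) u) ω)
      (fun n => 5 * 2 ^ (m + n) * p (m + n))
      (fun n => hinc n _ (gridPoints_subset_succ _ _ (gridFloor_mem hu _)) _ (gridFloor_mem hu _)
        (abs_gridFloor_succ_sub_le _ _)) hsum' l 0
    simpa [chainBound, Real.dist_eq] using this
  have h1 := tail s hs ls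
  have h2 := tail t ht lt
  have h3 : |X (gridFloor m s) ω - X (gridFloor m t) ω| ≤ chainBound p m := by
    refine (hinc 0 _ (gridPoints_subset_succ _ _ (gridFloor_mem hs _)) _
      (gridPoints_subset_succ _ _ (gridFloor_mem ht _)) (dist_gridFloor_le hst)).trans ?_
    exact hsum'.le_tsum 0 fun n _ => by have := hp (m + n); positivity
  rw [abs_le] at *
  constructor <;> linarith [h1.1, h1.2, h2.1, h2.2, h3.1, h3.2]

/-- Uniform modulus of continuity of a separable Gaussian process by chaining. -/
theorem ae_forall_dist_le_chainBound (h : IsGaussianWithCorrelationOn P (Set.Iic M) X A)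
    (hsep : IsSeparableOn P (Set.Iic M) X) (hp : ∀ n, 0 ≤ p n)
    (hA : ∀ n, ∀ s ≤ M, ∀ t ≤ M, dist s t ≤ 1 / gridSize n → 2 - 2 * A s t ≤ p n ^ 2)
    (hsum : Summable fun n => 5 * 2 ^ n * p n) :
    ∀ᵐ ω ∂P, ∀ m, ω ∉ largeIncrementFrom X M p m → ∀ s ≤ M, ∀ t ≤ M,
      dist s t < 1 / gridSize m → |X s ω - X t ω| ≤ 3 * chainBound p m := by
  obtain ⟨S, hSM, hSc, hS⟩ := hsep
  have hlim : ∀ᵐ ω ∂P, ∀ t ∈ S, Tendsto (fun n => X (gridFloor n t) ω) atTop (𝓝 (X t ω)) :=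
    (ae_ball_iff hSc).2 fun t ht => ae_tendsto_gridFloor h hp hA hsum (hSM ht)
  filter_upwards [hS, hlim] with ω hω hl m hm s hs t ht hst
  set G : Set (ℝ≥0 × ℝ) := (fun s : ℝ≥0 => (s, X s ω)) '' S
  have hmem : ((s, X s ω), (t, X t ω)) ∈ closure (G ×ˢ G) := by
    rw [closure_prod_eq]; exact ⟨hω s hs, hω t ht⟩
  set U : Set ((ℝ≥0 × ℝ) × (ℝ≥0 × ℝ)) := {q | dist q.1.1 q.2.1 < 1 / gridSize m} with hU
  have hUo : IsOpen U := isOpen_lt (by fun_prop) continuous_const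
  have hcl : IsClosed {q : (ℝ≥0 × ℝ) × (ℝ≥0 × ℝ) | |q.1.2 - q.2.2| ≤ 3 * chainBound p m} :=
    isClosed_le (by fun_prop) continuous_const
  -- Being strict, the distance condition is open, so a close pair of times is a limit of equally
  -- close pairs from the separating set.
  have hin := hUo.inter_closure ⟨hst, hmem⟩
  refine closure_minimal ?_ hcl hin
  rintro ⟨_, _⟩ ⟨hq, ⟨a, ha, rfl⟩, ⟨b, hb, rfl⟩⟩
  exact dist_le_of_notMem_largeIncrementFrom hp hsum hm (hSM ha) (hSM hb) hq (hl a ha) (hl b hb)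

end Chaining

/-! ### The correlation modulus. -/

section Modulus

theorem zero_mem_timeDomain (T : ℝ≥0∞) : (0 : ℝ≥0) ∈ timeDomain T := by
  simp [timeDomain]

variable {Ω : Type*} [MeasurableSpace Ω] {P : Measure Ω} {J : Set ℝ≥0} {X : ℝ≥0 → Ω → ℝ}
  {A : ℝ≥0 → ℝ≥0 → ℝ}

theorem IsGaussianWithCorrelationOn.bddBelow_corr (h : IsGaussianWithCorrelationOn P J X A)
    (hJ : ∀ s t : ℝ≥0, s ≤ t → t ∈ J → s ∈ J) (u : ℝ) :
    BddBelow {a : ℝ | ∃ s τ : ℝ≥0, (τ : ℝ) ≤ u ∧ s + τ ∈ J ∧ a = A s (s + τ)} := by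
  refine ⟨-1, ?_⟩
  rintro _ ⟨s, τ, -, hs, rfl⟩
  exact (h.abs_le_one (hJ _ _ le_self_add hs) hs).2

theorem IsGaussianWithCorrelationOn.corrModulus_mono (h : IsGaussianWithCorrelationOn P J X A)
    (hJ : ∀ s t : ℝ≥0, s ≤ t → t ∈ J → s ∈ J) (h0 : (0 : ℝ≥0) ∈ J) {u v : ℝ} (hu : 0 ≤ u)
    (huv : u ≤ v) : corrModulus J A u ≤ corrModulus J A v := by
  refine Real.sqrt_le_sqrt ?_
  -- The lag `0` makes the set nonempty since `u ≥ 0`; for `u < 0` the default `sInf ∅ = 0` would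
  -- break monotonicity.
  have := csInf_le_csInf (h.bddBelow_corr hJ v)
    (⟨A 0 (0 + 0), 0, 0, by simpa using hu, by simpa using h0, rfl⟩ :
      {a : ℝ | ∃ s τ : ℝ≥0, (τ : ℝ) ≤ u ∧ s + τ ∈ J ∧ a = A s (s + τ)}.Nonempty)
    (by rintro _ ⟨s, τ, hτ, hs, rfl⟩; exact ⟨s, τ, hτ.trans huv, hs, rfl⟩)
  linarith

theorem IsGaussianWithCorrelationOn.two_sub_le_corrModulus_sq
    (h : IsGaussianWithCorrelationOn P J X A) (hJ : ∀ s t : ℝ≥0, s ≤ t → t ∈ J → s ∈ J)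
    {s t : ℝ≥0} (hs : s ∈ J) (ht : t ∈ J) {u : ℝ} (hst : dist s t ≤ u) :
    2 - 2 * A s t ≤ corrModulus J A u ^ 2 := by
  wlog hle : s ≤ t generalizing s t
  · rw [h.symm hs ht]
    exact this ht hs (by rwa [dist_comm]) (le_of_not_ge hle)
  have hinf : sInf {a : ℝ | ∃ s τ : ℝ≥0, (τ : ℝ) ≤ u ∧ s + τ ∈ J ∧ a = A s (s + τ)} ≤ A s t := by
    refine csInf_le (h.bddBelow_corr hJ u) ⟨s, t - s, ?_, ?_, ?_⟩
    · rw [NNReal.coe_sub hle]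
      rw [NNReal.dist_eq, abs_sub_comm] at hst
      exact (le_abs_self _).trans hst
    · rwa [add_tsub_cancel_of_le hle]
    · rw [add_tsub_cancel_of_le hle]
  have h1 := (h.abs_le_one hs ht).1
  rw [corrModulus, Real.sq_sqrt (by linarith)]
  linarith

end Modulus

/-! ### From the entropy integral to the chaining sum. -/

section Integral

variable {q : ℝ → ℝ}

/-- The mesh `2^(-4^n)` is at most `exp (-v²)` at `v = 2^n / 2`, because `exp (1/4) ≤ 2`. -/
theorem inv_gridSize_le_exp (n : ℕ) :
    1 / (gridSize n : ℝ) ≤ Real.exp (-(2 ^ n / 2 : ℝ) ^ 2) := by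
  rw [gridSize, Real.exp_neg, inv_eq_one_div]
  push_cast
  refine one_div_le_one_div_of_le (Real.exp_pos _) ?_
  have h2 : Real.exp (1 / 4) ≤ 2 := by
    have h := Real.exp_one_lt_d9
    have : Real.exp (1 / 4) ≤ Real.exp (Real.log 2) := by
      gcongr
      have := Real.log_two_gt_d9
      linarith
    rwa [Real.exp_log two_pos] at this
  calc Real.exp ((2 ^ n / 2 : ℝ) ^ 2) = Real.exp (1 / 4) ^ 4 ^ n := by
        rw [← Real.exp_nat_mul]
        congr 1
        push_cast
        rw [show (4 : ℝ) ^ n = (2 ^ n) ^ 2 by rw [← pow_mul, mul_comm, pow_mul]; norm_num]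
        ring
    _ ≤ 2 ^ 4 ^ n := by gcongr

/-- The interval has length `2^n / 4`, so the factor `20` restores the threshold `5 · 2^n`. On it
`exp (-v²)` stays above the mesh. -/
theorem ofReal_dyadic_le_lintegral (hq0 : ∀ u, 0 ≤ q u)
    (hq : ∀ u v, 0 ≤ u → u ≤ v → q u ≤ q v) (n : ℕ) :
    ENNReal.ofReal (5 * 2 ^ n * q (1 / gridSize n)) ≤
      20 * ∫⁻ v in Set.Ioc (2 ^ n / 4 : ℝ) (2 ^ n / 2), ENNReal.ofReal (q (Real.exp (-v ^ 2))) := by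
  have hpos : (0 : ℝ) < 2 ^ n := by positivity
  calc ENNReal.ofReal (5 * 2 ^ n * q (1 / gridSize n))
      = 20 * ∫⁻ _ in Set.Ioc (2 ^ n / 4 : ℝ) (2 ^ n / 2),
          ENNReal.ofReal (q (1 / gridSize n)) := by
        rw [setLIntegral_const, Real.volume_Ioc, ← ENNReal.ofReal_mul (hq0 _),
          show (20 : ℝ≥0∞) = ENNReal.ofReal 20 by simp, ← ENNReal.ofReal_mul (by norm_num)]
        congr 1; ring
    _ ≤ _ := by
        gcongr 20 * ?_
        refine setLIntegral_mono' measurableSet_Ioc fun v hv => ?_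
        refine ENNReal.ofReal_le_ofReal (hq _ _ (by positivity)
          ((inv_gridSize_le_exp n).trans ?_))
        have : 0 ≤ v := le_trans (by positivity) hv.1.le
        gcongr
        exact hv.2

/-- The intervals of the levels `n ≥ m` abut, since `2^n / 2 = 2^(n+1) / 4`, so their integrals add
up to a tail of the entropy integral. -/
theorem chainBound_le_of_lintegral_le (hq0 : ∀ u, 0 ≤ q u)
    (hq : ∀ u v, 0 ≤ u → u ≤ v → q u ≤ q v) {m : ℕ} {η : ℝ} (hη : 0 ≤ η)
    (h : ∫⁻ v in Set.Ioi (2 ^ m / 4 : ℝ), ENNReal.ofReal (q (Real.exp (-v ^ 2)))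
      ≤ ENNReal.ofReal η) :
    Summable (fun n : ℕ => 5 * 2 ^ n * q (1 / gridSize n)) ∧
      chainBound (fun n => q (1 / gridSize n)) m ≤ 20 * η := by
  set g : ℕ → ℝ := fun n => 5 * 2 ^ (m + n) * q (1 / gridSize (m + n)) with hg
  have g0 : ∀ n, 0 ≤ g n := fun n => by have := hq0 (1 / gridSize (m + n)); positivity
  have hpart : ∀ N, ∑ n ∈ Finset.range N, g n ≤ 20 * η := by
    intro N
    have hmono : Monotone fun n : ℕ => (2 ^ (m + n) / 4 : ℝ) := fun a b hab => by
      have : (2 : ℝ) ^ (m + a) ≤ 2 ^ (m + b) := pow_le_pow_right₀ (by norm_num) (by omega)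
      beta_reduce; linarith
    have hint : ∀ n : ℕ, Set.Ioc (2 ^ (m + n) / 4 : ℝ) (2 ^ (m + n) / 2)
        = Set.Ioc (2 ^ (m + n) / 4 : ℝ) (2 ^ (m + (n + 1)) / 4) := fun n => by
      congr 1; rw [← add_assoc, pow_succ]; ring
    have h1 : ENNReal.ofReal (∑ n ∈ Finset.range N, g n) ≤ ENNReal.ofReal (20 * η) := by
      rw [ENNReal.ofReal_sum_of_nonneg fun n _ => g0 n]
      calc ∑ n ∈ Finset.range N, ENNReal.ofReal (g n)
          ≤ ∑' n, ENNReal.ofReal (g n) := ENNReal.sum_le_tsum _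
        _ ≤ ∑' n : ℕ, 20 * ∫⁻ v in Set.Ioc (2 ^ (m + n) / 4 : ℝ) (2 ^ (m + (n + 1)) / 4),
              ENNReal.ofReal (q (Real.exp (-v ^ 2))) := by
            refine ENNReal.tsum_le_tsum fun n => ?_
            rw [← hint]
            exact ofReal_dyadic_le_lintegral hq0 hq (m + n)
        _ = 20 * ∫⁻ v in ⋃ n : ℕ, Set.Ioc (2 ^ (m + n) / 4 : ℝ) (2 ^ (m + (n + 1)) / 4),
              ENNReal.ofReal (q (Real.exp (-v ^ 2))) := by
            rw [ENNReal.tsum_mul_left, lintegral_iUnion (fun _ => measurableSet_Ioc)]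
            exact hmono.pairwise_disjoint_on_Ioc_succ
        _ ≤ 20 * ∫⁻ v in Set.Ioi (2 ^ m / 4 : ℝ), ENNReal.ofReal (q (Real.exp (-v ^ 2))) := by
            gcongr 20 * ?_
            refine lintegral_mono_set (Set.iUnion_subset fun n v hv => ?_)
            exact lt_of_le_of_lt (by simpa using hmono (Nat.zero_le n)) hv.1
        _ ≤ 20 * ENNReal.ofReal η := by gcongr
        _ = ENNReal.ofReal (20 * η) := by
            rw [ENNReal.ofReal_mul (by norm_num)]; simp
    exact (ENNReal.ofReal_le_ofReal_iff (by positivity)).1 h1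
  have hs : Summable g := summable_of_sum_range_le g0 hpart
  refine ⟨?_, Real.tsum_le_of_sum_range_le g0 hpart⟩
  rw [← summable_nat_add_iff m]
  simpa only [hg, add_comm m] using hs

/-- The uniform Dudley condition makes the tails of the entropy integrals uniformly small. -/
theorem exists_forall_lintegral_tail_le {κ : Type*} {q : κ → ℝ → ℝ}
    (hq : ∀ k u v, 0 ≤ u → u ≤ v → q k u ≤ q k v)
    (h : Tendsto (fun δ : ℝ => ⨆ k, ∫⁻ v in Set.Ioi (0 : ℝ),
      ENNReal.ofReal (min (q k (Real.exp (-v ^ 2))) δ)) (𝓝[>] 0) (𝓝 0)) {η : ℝ} (hη : 0 < η) :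
    ∃ V : ℝ, 0 ≤ V ∧ ∀ k, ∫⁻ v in Set.Ioi V, ENNReal.ofReal (q k (Real.exp (-v ^ 2)))
      ≤ ENNReal.ofReal η := by
  have hev := (tendsto_order.1 h).2 _ (ENNReal.ofReal_pos.2 hη)
  obtain ⟨δ, hδ, hδ0⟩ := (hev.and self_mem_nhdsWithin).exists
  have hδ0' : (0 : ℝ) < δ := hδ0
  have hk : ∀ k, ∫⁻ v in Set.Ioi (0 : ℝ), ENNReal.ofReal (min (q k (Real.exp (-v ^ 2))) δ)
      < ENNReal.ofReal η := fun k => lt_of_le_of_lt (le_iSup (fun k => ∫⁻ v in Set.Ioi (0 : ℝ),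
      ENNReal.ofReal (min (q k (Real.exp (-v ^ 2))) δ)) k) hδ
  have hV0 : 0 ≤ η / δ := by positivity
  refine ⟨η / δ, hV0, fun k => ?_⟩
  -- Otherwise the truncated integrand equals `δ` on all of `(0, η / δ]` and the integral is at
  -- least `η`. Beyond `η / δ` the truncation is therefore inactive, simultaneously for all `k`.
  have hle : q k (Real.exp (-(η / δ) ^ 2)) ≤ δ := by
    by_contra hc
    refine absurd (hk k) (not_lt.2 ?_)
    calc ENNReal.ofReal η = ∫⁻ _ in Set.Ioc 0 (η / δ), ENNReal.ofReal δ := by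
          rw [setLIntegral_const, Real.volume_Ioc, ← ENNReal.ofReal_mul hδ0'.le]
          congr 1; field_simp; ring
      _ ≤ ∫⁻ v in Set.Ioc 0 (η / δ), ENNReal.ofReal (min (q k (Real.exp (-v ^ 2))) δ) := by
          refine setLIntegral_mono' measurableSet_Ioc fun v hv => ?_
          refine ENNReal.ofReal_le_ofReal (le_min ((not_le.1 hc).le.trans ?_) le_rfl)
          refine hq k _ _ (Real.exp_pos _).le ?_
          have := hv.1.le
          gcongr
          exact hv.2
      _ ≤ _ := lintegral_mono_set fun v hv => hv.1
  calc ∫⁻ v in Set.Ioi (η / δ), ENNReal.ofReal (q k (Real.exp (-v ^ 2)))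
      ≤ ∫⁻ v in Set.Ioi (η / δ), ENNReal.ofReal (min (q k (Real.exp (-v ^ 2))) δ) := by
        refine setLIntegral_mono' measurableSet_Ioi fun v hv => ?_
        have hv' : η / δ ≤ v := le_of_lt hv
        refine ENNReal.ofReal_le_ofReal (le_min le_rfl ((hq k _ _ (Real.exp_pos _).le ?_).trans
          hle))
        gcongr
    _ ≤ ∫⁻ v in Set.Ioi (0 : ℝ), ENNReal.ofReal (min (q k (Real.exp (-v ^ 2))) δ) :=
        lintegral_mono_set (Set.Ioi_subset_Ioi hV0)
    _ ≤ _ := (hk k).le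

theorem exists_forall_chainBound_le {κ : Type*} {q : κ → ℝ → ℝ} (hq0 : ∀ k u, 0 ≤ q k u)
    (hq : ∀ k u v, 0 ≤ u → u ≤ v → q k u ≤ q k v)
    (h : Tendsto (fun δ : ℝ => ⨆ k, ∫⁻ v in Set.Ioi (0 : ℝ),
      ENNReal.ofReal (min (q k (Real.exp (-v ^ 2))) δ)) (𝓝[>] 0) (𝓝 0)) {η : ℝ} (hη : 0 < η) :
    ∃ m : ℕ, ∀ m' ≥ m, ∀ k, Summable (fun n : ℕ => 5 * 2 ^ n * q k (1 / gridSize n)) ∧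
      3 * chainBound (fun n => q k (1 / gridSize n)) m' ≤ η := by
  -- Here `60 = 3 · 20`, the three legs of the chaining path times the loss in comparing sum and
  -- integral.
  obtain ⟨V, hV0, hV⟩ := exists_forall_lintegral_tail_le hq h (η := η / 60) (by positivity)
  obtain ⟨m, hm⟩ := exists_nat_ge (V * 4)
  refine ⟨m, fun m' hm' k => ?_⟩
  have h1 : V ≤ 2 ^ m' / 4 := by
    have h2 : m' < 2 ^ m' := Nat.lt_two_pow_self
    have h3 : (m' : ℝ) ≤ 2 ^ m' := by exact_mod_cast h2.le
    have h4 : (m : ℝ) ≤ m' := by exact_mod_cast hm'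
    linarith
  obtain ⟨h5, h6⟩ := chainBound_le_of_lintegral_le (hq0 k) (hq k) (m := m') (η := η / 60)
    (by positivity) ((lintegral_mono_set (Set.Ioi_subset_Ioi h1)).trans (hV k))
  exact ⟨h5, by linarith⟩

end Integral

/-! ### Compactness and measurability in `C[0, M]`. -/

section PathSpace

variable {M : ℝ≥0}

/-- The functions with given bound at the origin and given modulus of continuity. -/
def modulusSet (M : ℝ≥0) (L : ℝ) (r e : ℕ → ℝ) : Set (Set.Icc (0 : ℝ≥0) M → ℝ) :=
  {f | |f ⟨0, le_rfl, bot_le⟩| ≤ L ∧ ∀ j s t, dist s t < r j → |f s - f t| ≤ e j}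

theorem isClosed_modulusSet (L : ℝ) (r e : ℕ → ℝ) : IsClosed (modulusSet M L r e) := by
  have h1 : IsClosed {f : Set.Icc (0 : ℝ≥0) M → ℝ | |f ⟨0, le_rfl, bot_le⟩| ≤ L} :=
    isClosed_le (by fun_prop) continuous_const
  have h2 : IsClosed {f : Set.Icc (0 : ℝ≥0) M → ℝ |
      ∀ j s t, dist s t < r j → |f s - f t| ≤ e j} := by
    simp only [Set.ofPred_forall]
    exact isClosed_iInter fun j => isClosed_iInter fun s => isClosed_iInter fun t =>
      isClosed_iInter fun _ => isClosed_le (by fun_prop) continuous_const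
  exact h1.inter h2

/-- Walking from `t` down to `0` in steps `h < r 0` takes a number of steps bounded in terms of `M`,
and each costs at most `e 0`. -/
theorem exists_bound_modulusSet (M : ℝ≥0) (L : ℝ) {r e : ℕ → ℝ} (hr : 0 < r 0) :
    ∃ B : ℝ, ∀ f ∈ modulusSet M L r e, ∀ t, |f t| ≤ B := by
  obtain ⟨h, h0, hh⟩ : ∃ h : ℝ≥0, 0 < h ∧ (h : ℝ) < r 0 :=
    ⟨(r 0 / 2).toNNReal, Real.toNNReal_pos.2 (half_pos hr), by
      rw [Real.coe_toNNReal _ (half_pos hr).le]; exact half_lt_self hr⟩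
  have step : ∀ n : ℕ, ∀ f ∈ modulusSet M L r e, ∀ t : Set.Icc (0 : ℝ≥0) M,
      (t : ℝ≥0) ≤ n * h → |f t| ≤ L + n * e 0 := by
    intro n f hf
    induction n with
    | zero =>
      intro t ht
      have : t = ⟨0, le_rfl, bot_le⟩ := by
        ext; simpa using ht
      rw [this]; simpa using hf.1
    | succ n ih =>
      intro t ht
      have h1 : (t : ℝ≥0) - h ≤ n * h := by
        rw [tsub_le_iff_right]; push_cast at ht; linarith
      have h2 := ih ⟨(t : ℝ≥0) - h, bot_le, tsub_le_self.trans t.2.2⟩ h1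
      have hd : dist t ⟨(t : ℝ≥0) - h, bot_le, tsub_le_self.trans t.2.2⟩ < r 0 := by
        refine lt_of_le_of_lt ?_ hh
        rw [Subtype.dist_eq, NNReal.dist_eq]
        have e1 : (t : ℝ≥0) - h ≤ t := tsub_le_self
        have e2 : (t : ℝ≥0) ≤ (t - h) + h := le_tsub_add
        have e1' : (((t : ℝ≥0) - h : ℝ≥0) : ℝ) ≤ (t : ℝ≥0) := e1
        have e2' : (((t : ℝ≥0) : ℝ)) ≤ (((t : ℝ≥0) - h : ℝ≥0) : ℝ) + h := by exact_mod_cast e2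
        rw [abs_of_nonneg (by dsimp only; linarith)]
        dsimp only; linarith
      have h3 := hf.2 0 _ _ hd
      rw [abs_le] at *
      push_cast
      constructor <;> linarith [h2.1, h2.2, h3.1, h3.2]
  obtain ⟨n, hn⟩ := exists_nat_ge (M / h)
  refine ⟨L + n * e 0, fun f hf t => step n f hf t (t.2.2.trans ?_)⟩
  exact (div_le_iff₀ h0).1 hn

theorem isCompact_preimage_modulusSet (M : ℝ≥0) (L : ℝ) {r e : ℕ → ℝ} (hr : ∀ j, 0 < r j)
    (he : Tendsto e atTop (𝓝 0)) :
    IsCompact {f : C(Set.Icc (0 : ℝ≥0) M, ℝ) | (f : Set.Icc (0 : ℝ≥0) M → ℝ) ∈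
      modulusSet M L r e} := by
  have hsmall : ∀ ε > 0, ∃ j, e j < ε := fun ε hε => ((tendsto_order.1 he).2 ε hε).exists
  obtain ⟨B, hB⟩ := exists_bound_modulusSet M L (e := e) (hr 0)
  refine ArzelaAscoli.isCompact_of_equicontinuous _ ?_ ?_
  · have himage : ContinuousMap.toFun '' {f : C(Set.Icc (0 : ℝ≥0) M, ℝ) |
        (f : Set.Icc (0 : ℝ≥0) M → ℝ) ∈ modulusSet M L r e} = modulusSet M L r e := by
      ext f
      constructor
      · rintro ⟨g, hg, rfl⟩
        exact hg
      · intro hf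
        refine ⟨⟨f, ?_⟩, hf, rfl⟩
        rw [Metric.continuous_iff]
        intro t ε hε
        obtain ⟨j, hj⟩ := hsmall ε hε
        exact ⟨r j, hr j, fun s hs => lt_of_le_of_lt (hf.2 j s t hs) hj⟩
    rw [himage]
    refine IsCompact.of_isClosed_subset (isCompact_univ_pi fun _ => isCompact_Icc (a := -B) (b := B))
      (isClosed_modulusSet L r e) fun f hf t _ => abs_le.1 (hB f hf t)
  · intro t
    rw [Metric.equicontinuousAt_iff_right]
    intro ε hε
    obtain ⟨j, hj⟩ := hsmall ε hε
    filter_upwards [Metric.ball_mem_nhds t (hr j)] with s hs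
    rintro ⟨f, hf⟩
    refine lt_of_le_of_lt (hf.2 j t s ?_) hj
    rw [dist_comm]; exact hs

/-- A map into `C[0, M]` is measurable if all its evaluations are. -/
theorem measurable_continuousMap_of_eval {Ω : Type*} [MeasurableSpace Ω]
    {Y : Ω → C(Set.Icc (0 : ℝ≥0) M, ℝ)} (h : ∀ t, Measurable fun ω => Y ω t) : Measurable Y := by
  obtain ⟨D, hDc, hDd⟩ := TopologicalSpace.exists_countable_dense (Set.Icc (0 : ℝ≥0) M)
  have := hDc.to_subtype
  have : PolishSpace C(Set.Icc (0 : ℝ≥0) M, ℝ) := inferInstance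
  let ev : C(Set.Icc (0 : ℝ≥0) M, ℝ) → (D → ℝ) := fun f d => f d
  have hc : Continuous ev := continuous_pi fun d => continuous_eval_const _
  have hi : Function.Injective ev := fun f g hfg => by
    refine DFunLike.coe_injective (Continuous.ext_on hDd f.continuous g.continuous fun d hd => ?_)
    exact congrFun hfg ⟨d, hd⟩
  -- By Lusin-Souslin a continuous injection of a Polish space is a measurable embedding, so
  -- evaluations on a countable dense set generate the Borel structure.
  have hm : MeasurableEmbedding ev := hc.measurableEmbedding hi
  rw [← hm.measurable_comp_iff]
  exact measurable_pi_lambda _ fun d => h d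

/-- A process with almost surely continuous paths on `[0, M]` has a version with values in
`C[0, M]`. -/
theorem exists_continuousMap_version {Ω : Type*} [MeasurableSpace Ω] {P : Measure Ω}
    {X : ℝ≥0 → Ω → ℝ} (hX : ∀ t ≤ M, AEMeasurable (X t) P)
    (hc : ∀ᵐ ω ∂P, Continuous fun t : Set.Icc (0 : ℝ≥0) M => X t ω) :
    ∃ Y : Ω → C(Set.Icc (0 : ℝ≥0) M, ℝ), Measurable Y ∧ ∀ᵐ ω ∂P, ∀ t, Y ω t = X t ω := by
  classical
  obtain ⟨D, hDc, hDd⟩ := TopologicalSpace.exists_countable_dense (Set.Icc (0 : ℝ≥0) M)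
  have hD : ∀ᵐ ω ∂P, ∀ d ∈ D, X d ω = (hX d d.2.2).mk (X d) ω :=
    (ae_ball_iff hDc).2 fun d _ => (hX d d.2.2).ae_eq_mk
  have hgood := hc.and hD
  -- The exceptional set is enlarged to a measurable null set, so that setting the path to `0` there
  -- gives a genuinely measurable map.
  set N := toMeasurable P {ω | ¬ ((Continuous fun t : Set.Icc (0 : ℝ≥0) M => X t ω) ∧
    ∀ d (_ : d ∈ D), X d ω = (hX d d.2.2).mk (X d) ω)} with hN
  have hN0 : P N = 0 := by rw [hN, measure_toMeasurable]; exact hgood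
  have hNm : MeasurableSet N := measurableSet_toMeasurable _ _
  have hgood' : ∀ ω ∉ N, (Continuous fun t : Set.Icc (0 : ℝ≥0) M => X t ω) ∧
      ∀ d (_ : d ∈ D), X d ω = (hX d d.2.2).mk (X d) ω := fun ω hω => by
    by_contra h
    exact hω (subset_toMeasurable _ _ h)
  let Y : Ω → C(Set.Icc (0 : ℝ≥0) M, ℝ) := fun ω =>
    if h : ω ∈ N then 0 else ⟨fun t => X t ω, (hgood' ω h).1⟩
  have hYD : ∀ d ∈ D, Measurable fun ω => Y ω d := by
    intro d hd
    have : (fun ω => Y ω d) = fun ω => if ω ∈ N then 0 else (hX d d.2.2).mk (X d) ω := by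
      ext ω
      by_cases hω : ω ∈ N
      · simp [Y, hω]
      · simp [Y, hω, ← (hgood' ω hω).2 d hd]
    rw [this]
    exact Measurable.ite hNm measurable_const (hX d d.2.2).measurable_mk
  refine ⟨Y, measurable_continuousMap_of_eval fun t => ?_, ?_⟩
  · obtain ⟨u, hu, hut⟩ := mem_closure_iff_seq_limit.1 (hDd t)
    refine measurable_of_tendsto_metrizable (fun n => hYD (u n) (hu n)) ?_
    rw [tendsto_pi_nhds]
    intro ω
    exact ((Y ω).continuous.tendsto t).comp hut
  · filter_upwards [measure_eq_zero_iff_ae_notMem.1 hN0] with ω hω t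
    simp [Y, hω]

end PathSpace

/-! ### Continuity and tightness under the uniform Dudley condition. -/

section Dudley

variable {Ω : ℕ∞ → Type*} [∀ k, MeasurableSpace (Ω k)] {P : ∀ k, Measure (Ω k)}
  {T : ℕ∞ → ℝ≥0∞} {Z : ∀ k, ℝ≥0 → Ω k → ℝ} {A : ℕ∞ → ℝ≥0 → ℝ≥0 → ℝ}

/-- The correlation modulus of the `k`-th process at the scale of the `n`-th grid. -/
noncomputable def gridModulus (T : ℕ∞ → ℝ≥0∞) (A : ℕ∞ → ℝ≥0 → ℝ≥0 → ℝ) (k : ℕ∞) (n : ℕ) : ℝ :=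
  corrModulus (timeDomain (T k)) (A k) (1 / gridSize n)

theorem gridModulus_nonneg (k : ℕ∞) (n : ℕ) : 0 ≤ gridModulus T A k n := Real.sqrt_nonneg _

theorem UniformDudley.exists_forall_chainBound_le
    (hZ : ∀ k, IsGaussianWithCorrelationOn (P k) (timeDomain (T k)) (Z k) (A k))
    (hU : UniformDudley T A) {η : ℝ} (hη : 0 < η) :
    ∃ m : ℕ, ∀ m' ≥ m, ∀ k, Summable (fun n : ℕ => 5 * 2 ^ n * gridModulus T A k n) ∧
      3 * chainBound (gridModulus T A k) m' ≤ η :=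
  _root_.exists_forall_chainBound_le (q := fun k => corrModulus (timeDomain (T k)) (A k))
    (fun _ _ => Real.sqrt_nonneg _)
    (fun k _ _ hu huv => (hZ k).corrModulus_mono (fun _ _ => mem_timeDomain_of_le)
      (zero_mem_timeDomain _) hu huv) hU hη

/-- Under the uniform Dudley condition, all shifted processes share a modulus of continuity
outside of events of uniformly small probability. -/
theorem UniformDudley.ae_forall_dist_le
    (hZ : ∀ k, IsGaussianWithCorrelationOn (P k) (timeDomain (T k)) (Z k) (A k))
    (hsep : ∀ k, IsSeparableOn (P k) (timeDomain (T k)) (Z k))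
    (hU : UniformDudley T A) {k : ℕ∞} {s M : ℝ≥0} (hs : s + M ∈ timeDomain (T k)) :
    (∀ m, P k (largeIncrementFrom (fun t => Z k (s + t)) M (gridModulus T A k) m)
      ≤ ENNReal.ofReal (4 * (M + 1) ^ 2 * (1 / 2) ^ m)) ∧
    ∀ᵐ ω ∂(P k), ∀ m,
      ω ∉ largeIncrementFrom (fun t => Z k (s + t)) M (gridModulus T A k) m →
      ∀ t ≤ M, ∀ u ≤ M, dist t u < 1 / gridSize m →
        |Z k (s + t) ω - Z k (s + u) ω| ≤ 3 * chainBound (gridModulus T A k) m := by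
  have hdom : ∀ t ≤ M, s + t ∈ timeDomain (T k) := fun t ht =>
    mem_timeDomain_of_le (by gcongr) hs
  have hX := (hZ k).shift (J' := Set.Iic M) s hdom
  have hcov : ∀ n, ∀ t ≤ M, ∀ u ≤ M, dist t u ≤ 1 / gridSize n →
      2 - 2 * A k (s + t) (s + u) ≤ gridModulus T A k n ^ 2 := fun n t ht u hu htu =>
    (hZ k).two_sub_le_corrModulus_sq (fun _ _ => mem_timeDomain_of_le) (hdom t ht) (hdom u hu)
      (by simpa [NNReal.dist_eq] using htu)
  obtain ⟨m, hm⟩ := hU.exists_forall_chainBound_le hZ one_pos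
  exact ⟨fun m => measure_largeIncrementFrom_le hX (gridModulus_nonneg k) hcov m,
    ae_forall_dist_le_chainBound hX ((hsep k).shift s M hdom) (gridModulus_nonneg k) hcov
      (hm m le_rfl k).1⟩

theorem tendsto_chaining_prob (M : ℝ≥0) :
    Tendsto (fun m : ℕ => ENNReal.ofReal (4 * (M + 1) ^ 2 * (1 / 2) ^ m)) atTop (𝓝 0) := by
  rw [← ENNReal.ofReal_zero]
  refine ENNReal.tendsto_ofReal ?_
  have := (tendsto_pow_atTop_nhds_zero_of_lt_one (r := (1 / 2 : ℝ)) (by norm_num)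
    (by norm_num)).const_mul (4 * ((M : ℝ) + 1) ^ 2)
  simpa using this

theorem UniformDudley.ae_continuous
    (hZ : ∀ k, IsGaussianWithCorrelationOn (P k) (timeDomain (T k)) (Z k) (A k))
    (hsep : ∀ k, IsSeparableOn (P k) (timeDomain (T k)) (Z k))
    (hU : UniformDudley T A) {k : ℕ∞} {s M : ℝ≥0} (hs : s + M ∈ timeDomain (T k)) :
    ∀ᵐ ω ∂(P k), Continuous fun t : Set.Icc (0 : ℝ≥0) M => Z k (s + t) ω := by
  obtain ⟨hp, hae⟩ := hU.ae_forall_dist_le hZ hsep hs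
  -- Almost every path escapes one of these decreasing events, hence all later ones, and so obeys
  -- the chaining modulus at every fine enough scale.
  have hnull : P k (⋂ m, largeIncrementFrom (fun t => Z k (s + t)) M (gridModulus T A k) m) = 0 :=
    le_antisymm (ge_of_tendsto' (tendsto_chaining_prob M) fun m =>
      (measure_mono (Set.iInter_subset _ m)).trans (hp m)) bot_le
  filter_upwards [hae, measure_eq_zero_iff_ae_notMem.1 hnull] with ω hω hmem
  obtain ⟨m₀, hm₀⟩ : ∃ m, ω ∉ largeIncrementFrom (fun t => Z k (s + t)) M
      (gridModulus T A k) m := by simpa using hmem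
  rw [Metric.continuous_iff]
  intro t ε hε
  obtain ⟨m, hm⟩ := hU.exists_forall_chainBound_le hZ (half_pos hε)
  refine ⟨1 / gridSize (max m m₀), one_div_pos.2 (by exact_mod_cast gridSize_pos _),
    fun u hu => ?_⟩
  have := hω (max m m₀) (fun h => hm₀ (antitone_largeIncrementFrom (le_max_right _ _) h))
    u u.2.2 t t.2.2 hu
  rw [Real.dist_eq]
  linarith [(hm (max m m₀) (le_max_left _ _) k).2]

/-- The uniform Dudley condition gives uniform tightness. -/
theorem UniformDudley.uniformlyTightOn [∀ k, IsProbabilityMeasure (P k)]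
    (hZ : ∀ k, IsGaussianWithCorrelationOn (P k) (timeDomain (T k)) (Z k) (A k))
    (hsep : ∀ k, IsSeparableOn (P k) (timeDomain (T k)) (Z k))
    (hU : UniformDudley T A) (M : ℝ≥0) : UniformlyTightOn P T Z M := by
  classical
  have hver : ∀ k s, s + M ∈ timeDomain (T k) → ∃ Y : Ω k → C(Set.Icc (0 : ℝ≥0) M, ℝ),
      Measurable Y ∧ ∀ᵐ ω ∂(P k), ∀ t : Set.Icc (0 : ℝ≥0) M, Y ω t = Z k (s + t) ω :=
    fun k s hs => exists_continuousMap_version (X := fun t => Z k (s + t))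
      (fun t ht => (hZ k).aemeasurable (mem_timeDomain_of_le (by gcongr) hs))
      (hU.ae_continuous hZ hsep hs)
  let Y : ∀ k, ℝ≥0 → Ω k → C(Set.Icc (0 : ℝ≥0) M, ℝ) := fun k s =>
    if hs : s + M ∈ timeDomain (T k) then (hver k s hs).choose else fun _ => 0
  have hY : ∀ k s, s + M ∈ timeDomain (T k) → Measurable (Y k s) ∧
      ∀ᵐ ω ∂(P k), ∀ t : Set.Icc (0 : ℝ≥0) M, Y k s ω t = Z k (s + t) ω := fun k s hs => by
    simp only [Y, hs, dif_pos]
    exact (hver k s hs).choose_spec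
  refine ⟨Y, hY, ?_⟩
  rw [isTightMeasureSet_iff_exists_isCompact_measure_compl_le]
  intro ε hε
  have hε2 : 0 < ε / 2 := ENNReal.half_pos hε.ne'
  obtain ⟨m₀, hm₀⟩ := ((tendsto_order.1 (tendsto_chaining_prob M)).2 _ hε2).exists
  obtain ⟨L, hL⟩ := exists_nat_measure_lt_abs_lt (P := gaussianReal 0 1) (f := id)
    aemeasurable_id hε2
  choose μ hμ using fun j : ℕ => hU.exists_forall_chainBound_le hZ
    (η := 1 / ((j : ℝ) + 1)) (by positivity)
  -- Taking scales at least `m₀` lets the single event at level `m₀` control all `j` at once, with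
  -- no sum of exceptional probabilities.
  set K := {f : C(Set.Icc (0 : ℝ≥0) M, ℝ) | (f : Set.Icc (0 : ℝ≥0) M → ℝ) ∈ modulusSet M L
    (fun j => 1 / gridSize (max (μ j) m₀)) fun j => 1 / ((j : ℝ) + 1)} with hK
  have hKc : IsCompact K := isCompact_preimage_modulusSet M L
    (fun j => one_div_pos.2 (by exact_mod_cast gridSize_pos _))
    tendsto_one_div_add_atTop_nhds_zero_nat
  refine ⟨K, hKc, ?_⟩
  rintro _ ⟨k, s, hs, rfl⟩
  obtain ⟨hYm, hYae⟩ := hY k s hs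
  obtain ⟨hp, hae⟩ := hU.ae_forall_dist_le hZ hsep hs
  have hs0 : s ∈ timeDomain (T k) := mem_timeDomain_of_le le_self_add hs
  -- Every `Z k s` is standard normal, so one `L` serves all `k` and `s`.
  have hlaw : P k {ω | (L : ℝ) < |Z k s ω|} < ε / 2 := by
    have hG := (hZ k).gaussian.hasGaussianLaw_eval ⟨s, hs0⟩
    have hmap := hG.map_eq_gaussianReal
    have hv : Var[Z k s; P k] = 1 := by
      rw [variance_of_integral_eq_zero hG.aemeasurable ((hZ k).centered s hs0)]
      exact (hZ k).normalized s hs0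
    rw [(hZ k).centered s hs0, hv, Real.toNNReal_one] at hmap
    rw [← hmap, Measure.map_apply_of_aemeasurable hG.aemeasurable
      (measurableSet_lt measurable_const (by fun_prop))] at hL
    exact hL
  rw [Measure.map_apply hYm hKc.isClosed.measurableSet.compl]
  calc P k (Y k s ⁻¹' Kᶜ)
      ≤ P k ({ω | (L : ℝ) < |Z k s ω|} ∪
          largeIncrementFrom (fun t => Z k (s + t)) M (gridModulus T A k) m₀) := by
        refine measure_mono_ae ?_
        filter_upwards [hYae, hae] with ω h1 h2 hω
        by_contra hcon
        have hc := not_or.1 hcon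
        refine hω ⟨?_, fun j t u htu => ?_⟩
        · rw [h1]
          simpa using hc.1
        · rw [h1, h1]
          exact (h2 (max (μ j) m₀)
            (fun h => hc.2 (antitone_largeIncrementFrom (le_max_right _ _) h)) t t.2.2 u u.2.2
            htu).trans (hμ j _ (le_max_left _ _) k).2
    _ ≤ ε / 2 + ε / 2 := (measure_union_le _ _).trans (add_le_add hlaw.le ((hp m₀).trans hm₀.le))
    _ = ε := ENNReal.add_halves ε

end Dudley

theorem stationary_corr_eq {Ω : Type*} [MeasurableSpace Ω] {P : Measure Ω} {J : Set ℝ≥0}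
    {X : ℝ≥0 → Ω → ℝ} {A : ℝ≥0 → ℝ≥0 → ℝ} (hX : IsGaussianWithCorrelationOn P J X A)
    (hA : ∀ s τ : ℝ≥0, s + τ ∈ J → A s (s + τ) = A 0 τ) {t u : ℝ≥0} (ht : t ∈ J) (hu : u ∈ J) :
    A t u = A 0 (nndist t u) := by
  wlog htu : t ≤ u generalizing t u
  · rw [hX.symm ht hu, nndist_comm]
    exact this hu ht (le_of_not_ge htu)
  obtain ⟨τ, rfl⟩ := exists_add_of_le htu
  rw [hA t τ hu]
  congr 1
  ext
  rw [coe_nndist, NNReal.dist_eq]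
  push_cast
  rw [sub_add_cancel_left, abs_neg, abs_of_nonneg τ.coe_nonneg]

/-! ### Convergence of the probabilities for stationary correlations. -/

section Stationary

variable {Ω : ℕ∞ → Type*} [∀ k, MeasurableSpace (Ω k)] {P : ∀ k, Measure (Ω k)}
  {T : ℕ∞ → ℝ≥0∞} {Z : ∀ k, ℝ≥0 → Ω k → ℝ} {A : ℕ∞ → ℝ≥0 → ℝ≥0 → ℝ}

/-- Pointwise convergence of stationary correlations together with the uniform Dudley condition
implies convergence at every level and for every horizon. -/
theorem supProbConvergesAt_of_stationary [∀ k, IsProbabilityMeasure (P k)]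
    (hT_top : T ⊤ = ⊤) (hT : Tendsto (fun k : ℕ => T k) atTop (𝓝 ⊤))
    (hZ : ∀ k, IsGaussianWithCorrelationOn (P k) (timeDomain (T k)) (Z k) (A k))
    (hsep : ∀ k, IsSeparableOn (P k) (timeDomain (T k)) (Z k))
    (hA : IsStationaryCorrelationOn Set.univ (A ⊤))
    (hconv : ∀ τ : ℝ≥0, Tendsto (fun k : ℕ => A k 0 τ) atTop (𝓝 (A ⊤ 0 τ)))
    (hU : UniformDudley T A)
    (hst : ∀ k : ℕ, IsStationaryCorrelationOn (timeDomain (T k)) (A k)) (z : ℝ) (M : ℝ≥0) :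
    SupProbConvergesAt P T Z z M := by
  -- By stationarity this error bound does not involve the shift, so pointwise convergence at
  -- finitely many lags is uniform over all windows.
  let e : Finset ℝ≥0 → ℕ → ℝ := fun F k =>
    ∑ t ∈ F, ∑ u ∈ F, |A k 0 (nndist t u) - A ⊤ 0 (nndist t u)|
  have he : ∀ (F : Finset ℝ≥0) (C : ℝ), Tendsto (fun k => ENNReal.ofReal (C * e F k)) atTop
      (𝓝 0) := by
    intro F C
    have h0 : Tendsto (e F) atTop (𝓝 (∑ t ∈ F, ∑ u ∈ F, (0 : ℝ))) := by
      refine tendsto_finsetSum _ fun t _ => tendsto_finsetSum _ fun u _ => ?_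
      have := ((hconv (nndist t u)).sub_const (A ⊤ 0 (nndist t u))).abs
      simpa using this
    rw [← ENNReal.ofReal_zero]
    refine ENNReal.tendsto_ofReal ?_
    simpa using h0.const_mul C
  have hmem : ∀ t, t ∈ timeDomain (T ⊤) := fun t => by
    rw [hT_top]; exact (le_top : (t : ℝ≥0∞) ≤ ⊤)
  have hX := (hZ ⊤).mono (J' := Set.Iic M) fun t _ => hmem t
  have hdom : ∀ (k : ℕ) (s : ℝ≥0), s + M ∈ timeDomain (T k) → ∀ t ≤ M,
      s + t ∈ timeDomain (T k) := fun k s hs t ht => mem_timeDomain_of_le (by gcongr) hs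
  have hcorr : ∀ (k : ℕ) (s : ℝ≥0), s + M ∈ timeDomain (T k) → ∀ t ≤ M, ∀ u ≤ M,
      A k (s + t) (s + u) = A k 0 (nndist t u) := fun k s hs t ht u hu => by
    rw [stationary_corr_eq (hZ k) (hst k).stationary (hdom k s hs t ht) (hdom k s hs u hu)]
    congr 1
    ext
    simp [NNReal.dist_eq]
  have hcorr' : ∀ t u, A ⊤ t u = A ⊤ 0 (nndist t u) := fun t u =>
    stationary_corr_eq (hZ ⊤) (fun s τ _ => hA.stationary s τ trivial) (hmem t) (hmem u)
  have hsum : ∀ (F : Finset ℝ≥0), (∀ t ∈ F, t ∈ Set.Iic M) → ∀ (k : ℕ) (s : ℝ≥0),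
      s + M ∈ timeDomain (T k) →
      ∑ t ∈ F, ∑ u ∈ F, max 0 (A k (s + t) (s + u) - A ⊤ t u) ≤ e F k ∧
      ∑ t ∈ F, ∑ u ∈ F, max 0 (A ⊤ t u - A k (s + t) (s + u)) ≤ e F k := by
    intro F hF k s hs
    constructor <;> refine Finset.sum_le_sum fun t ht => Finset.sum_le_sum fun u hu => ?_ <;>
      rw [hcorr k s hs t (hF t ht) u (hF u hu), hcorr' t u]
    · exact max_le (abs_nonneg _) (le_abs_self _)
    · rw [abs_sub_comm]
      exact max_le (abs_nonneg _) (le_abs_self _)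
  refine supProbConvergesAt_of_bounds hT_top hT hZ hsep ?_ ?_
  · intro c hc
    obtain ⟨b, hcb, hbz⟩ := exists_between hc
    refine ENNReal.le_of_forall_pos_le_add fun δ hδ _ => ?_
    have hδ2 : (0 : ℝ≥0∞) < δ / 2 := ENNReal.half_pos (by exact_mod_cast hδ.ne')
    -- Grid values below `b` and oscillation at most `(z - b) / 2` keep the whole path below `(b +
    -- z) / 2 < z`. The grid is chosen before `k`, so the Slepian constant is fixed when `k → ∞`.
    obtain ⟨m₁, hm₁⟩ := hU.exists_forall_chainBound_le hZ (η := (z - b) / 2) (by linarith)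
    obtain ⟨m, hmδ, hm⟩ := (((tendsto_order.1 (tendsto_chaining_prob M)).2 _ hδ2).and
      (eventually_ge_atTop m₁)).exists
    obtain ⟨C, hC0, hC⟩ := exists_forall_measure_le_add_corr (gridPoints M m) hcb
    rw [← tsub_le_iff_right]
    refine le_liminf_of_le (by isBoundedDefault) ?_
    filter_upwards [(tendsto_order.1 (he (gridPoints M m) C)).2 _ hδ2] with k hk
    refine le_iInf₂ fun s hs => ?_
    obtain ⟨hp, hae⟩ := hU.ae_forall_dist_le hZ hsep hs
    have hmemF : ∀ t ∈ gridPoints M m, t ∈ Set.Iic M := fun t ht => le_of_mem_gridPoints ht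
    have h1 := hC ((hZ k).shift (J' := Set.Iic M) s (hdom k s hs)) hX hmemF
    have h2 : P k {ω | ∀ t ∈ gridPoints M m, Z k (s + t) ω < b} ≤
        P k {ω | pathSup (Z k) s M ω < z} + δ / 2 := by
      calc _ ≤ P k ({ω | pathSup (Z k) s M ω < z} ∪
            largeIncrementFrom (fun t => Z k (s + t)) M (gridModulus T A k) m) := by
            refine measure_mono_ae ?_
            filter_upwards [hae] with ω hω hb
            by_contra hcon
            have hc := not_or.1 hcon
            refine hc.1 ?_
            refine lt_of_le_of_lt (b := (((b + z) / 2 : ℝ) : EReal)) ?_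
              (by exact_mod_cast (by linarith : (b + z) / 2 < z))
            refine iSup₂_le fun t ht => ?_
            have hg := gridFloor_mem ht m
            have h3 := hω m hc.2 t ht _ (le_of_mem_gridPoints hg)
              (by rw [dist_comm]; exact dist_gridFloor_self_lt m t)
            have h4 := hb _ hg
            have h5 := (hm₁ m hm k).2
            exact_mod_cast (by linarith [(abs_le.1 h3).2] : Z k (s + t) ω ≤ (b + z) / 2)
        _ ≤ _ := (measure_union_le _ _).trans (add_le_add le_rfl ((hp m).trans hmδ.le))
    rw [tsub_le_iff_right]
    calc P ⊤ {ω | pathSup (Z ⊤) 0 M ω ≤ c}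
        ≤ P ⊤ {ω | ∀ t ∈ gridPoints M m, Z ⊤ t ω ≤ c} :=
          measure_mono fun ω hω t ht => (pathSup_le_iff.1 hω) t (hmemF t ht)
      _ ≤ _ := h1
      _ ≤ (P k {ω | pathSup (Z k) s M ω < z} + δ / 2) + δ / 2 :=
          add_le_add h2 ((ENNReal.ofReal_le_ofReal
            (mul_le_mul_of_nonneg_left (hsum _ hmemF k s hs).2 hC0)).trans hk.le)
      _ = _ := by rw [add_assoc, ENNReal.add_halves]
  · intro F hF η hη
    obtain ⟨C, hC0, hC⟩ := exists_forall_measure_le_add_corr F (lt_add_of_pos_right z hη)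
    refine ENNReal.le_of_forall_pos_le_add fun δ hδ _ => ?_
    refine limsup_le_of_le (by isBoundedDefault) ?_
    filter_upwards [(tendsto_order.1 (he F C)).2 δ (by exact_mod_cast hδ)] with k hk
    refine iSup₂_le fun s hs => ?_
    have h1 := hC hX ((hZ k).shift (J' := Set.Iic M) s (hdom k s hs)) hF
    refine h1.trans (add_le_add (measure_mono fun ω hω t ht => (hω t ht).le) ?_)
    exact (ENNReal.ofReal_le_ofReal
      (mul_le_mul_of_nonneg_left (hsum _ hF k s hs).1 hC0)).trans hk.le

end Stationary

/-! ### Assembly of the two parts. -/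

theorem mainTheorem5
    {Ω : ℕ∞ → Type*} [∀ k, MeasurableSpace (Ω k)]
    (P : ∀ k, Measure (Ω k)) [∀ k, IsProbabilityMeasure (P k)]
    (T : ℕ∞ → ℝ≥0∞) (hT_top : T ⊤ = ⊤) (hT : Tendsto (fun k : ℕ => T k) atTop (𝓝 ⊤))
    (Z : ∀ k, ℝ≥0 → Ω k → ℝ) (A : ℕ∞ → ℝ≥0 → ℝ≥0 → ℝ)
    (hZ : ∀ k, IsGaussianWithCorrelationOn (P k) (timeDomain (T k)) (Z k) (A k))
    (hsep : ∀ k, IsSeparableOn (P k) (timeDomain (T k)) (Z k))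
    (hA : IsStationaryCorrelationOn Set.univ (A ⊤)) :
    -- the sandwich condition suffices
    (∀ (Ω' : Type*) [MeasurableSpace Ω'] (P' : Measure Ω') [IsProbabilityMeasure P']
        (V : ℝ≥0 → Ω' → ℝ) (D : ℝ≥0 → ℝ≥0 → ℝ),
        IsStationaryCorrelationOn Set.univ D →
        IsGaussianWithCorrelationOn P' Set.univ V D →
        (∀ᵐ ω ∂P', Continuous fun t => V t ω) →
        (∀ M : ℝ≥0, ∃ ε : ℕ → ℝ, (∀ k, 0 < ε k) ∧ Tendsto ε atTop (𝓝 0) ∧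
          ∀ (k : ℕ) (s τ : ℝ≥0), τ ≤ M → s + τ ∈ timeDomain (T k) →
            (1 - ε k) * A ⊤ 0 τ + ε k * D 0 τ ≤ A k s (s + τ) ∧
            A k s (s + τ) ≤ (1 - ε k) * A ⊤ 0 τ + ε k) →
        SupProbConverges P T Z) ∧
    -- pointwise convergence with the uniform Dudley condition gives tightness, and suffices
    -- in the stationary case
    ((∀ s τ : ℝ≥0, Tendsto (fun k : ℕ => A k s (s + τ)) atTop (𝓝 (A ⊤ 0 τ))) →
      UniformDudley T A →
      (∀ M : ℝ≥0, UniformlyTightOn P T Z M) ∧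
      ((∀ k : ℕ, IsStationaryCorrelationOn (timeDomain (T k)) (A k)) →
        ∀ (z : ℝ) (M : ℝ≥0), SupProbConvergesAt P T Z z M)) := by
  -- The choices `ζ = 1` and `M₁ = 0` are arbitrary: the sandwich gives every level and every
  -- horizon.
  refine ⟨fun Ω' _ P' _ V D hD hV hVc hs => ⟨1, one_pos, 0, fun z _ M _ => ?_⟩,
    fun hconv hU => ⟨fun M => hU.uniformlyTightOn hZ hsep M, fun hst z M =>
      supProbConvergesAt_of_stationary hT_top hT hZ hsep hA (fun τ => ?_) hU hst z M⟩⟩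
  · obtain ⟨ε, hε0, hε, hsand⟩ := hs M
    exact supProbConvergesAt_of_sandwich hT_top hT hZ hsep hA hD hV hVc hε0 hε hsand z
  · simpa using hconv 0 τ
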